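/- **Model.** Let $\alpha>2$, $P_R,P_j,\beta_e>0$, $0<L_1<L_2$, $L_G\ge 0$, $y\in\mathbb R^2$ and $\lambda_R,\lambda_J,\lambda_e\ge 0$. Write $d_{x,x'}=\|x-x'\|$ for the Euclidean distance, $\mathcal A(x,r)$ for the disk with centre $x$ and radius $r$, $\mathcal D=\mathcal D(L_1,L_2)=\{x\in\mathbb R^2: L_1\le\|x\|\le L_2\}$ and $\overline{\mathcal D}=\mathcal D\setminus\mathcal A(y,L_G)$. The relays $\Phi_R$ form a homogeneous Poisson point process (PPP) of density $\lambda_R$ on $\mathcal A(0,L_1)$, the jammers $\Phi_J$ a homogeneous PPP of density $\lambda_J$ on $\mathcal D$, and the eavesdroppers $\Phi_E$ a homogeneous PPP of density $\lambda_e$ on $\mathcal D$. The channel coefficients $H_{x_R,y}$ (from relay to destination $y$) and $H_{x_R,z}$ (from relay to eavesdropper) are i.i.d. $\mathcal{CN}(0,1)$, the power fadings $h_{x_J,z}$ from jammer to eavesdropper are i.i.d. exponential with mean $1$, and the three point processes and all the fading variables are mutually independent. For a receiver at $z$ put $$T(z)=\Big|\sum_{x_R\in\Phi_R}\frac{\sqrt{P_R}\,H_{x_R,z}\overline{H_{x_R,y}}}{|H_{x_R,y}|}\,d_{x_R,z}^{-\alpha/2}\Big|^2,\qquad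 I(z)=\sum_{x_J\in\Phi_J\setminus\mathcal A(y,L_G)}P_j\,h_{x_J,z}\,d_{x_J,z}^{-\alpha},\qquad \mathrm{SIR}_z=\frac{T(z)}{I(z)}\in[0,\infty],$$ where $t/0=\infty$ for $t>0$, and $0/0$ is given an arbitrary fixed value $c\in[0,\infty]$. The secrecy outage probability is $\mathcal P_{so}=\mathbb P\big(\bigcup_{z\in\Phi_E}\{\mathrm{SIR}_z>\beta_e\}\big)$. Put $$\overline{\mathcal P}_{so}=1-\exp\Big[-\lambda_e\int_{\mathcal D}\mathbb E_{\Phi_R,\Phi_J}\big[\mathbb P(\mathrm{SIR}_z>\beta_e\mid\Phi_R,\Phi_J)\big]\,dz\Big],$$ where in the integrand $z$ is the fixed location of a receiver whose fading variables have the above laws and are independent of $\Phi_R,\Phi_J$, and $$B=1-\exp\Big[-\lambda_e\int_{\mathcal D}\mathbb E_{\Phi_R}\Big[\exp\Big(-\lambda_J\int_{\overline{\mathcal D}}\frac{\beta_eP_jd_{x_J,z}^{-\alpha}}{\sum_{x_R\in\Phi_R}P_Rd_{x_R,z}^{-\alpha}+\beta_eP_jd_{x_J,z}^{-\alpha}}\,dx_J\Big)\Big]dz\Big].$$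 **Theorem.** For every convention $c\in[0,\infty]$, $$\mathcal P_{so}\le\overline{\mathcal P}_{so}\le B,\qquad\text{in particular}\qquad \mathcal P_{so}\le B,$$ and $\overline{\mathcal P}_{so}=B$ whenever $c>\beta_e$ (for instance $c=\infty$). -/

import Mathlib

open MeasureTheory ProbabilityTheory
open scoped NNReal ENNReal ComplexConjugate

noncomputable section

namespace SecrecyOutage

/-- The Euclidean plane. -/
abbrev Plane : Type := EuclideanSpace ℝ (Fin 2)

/-- The disk with centre `x` and radius `r`. -/
def disk (x : Plane) (r : ℝ) : Set Plane := Metric.ball x r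

/-- The annulus with internal radius `L₁` and external radius `L₂`, centred at the origin. -/
def annulus (L₁ L₂ : ℝ) : Set Plane := {x | L₁ ≤ ‖x‖ ∧ ‖x‖ ≤ L₂}

/-- A finite configuration of points of the plane, listed in some order (repetitions allowed). -/
abbrev Config : Type := Σ n : ℕ, (Fin n → Plane)

/-- The number of points of the configuration `c` that lie in `A`. -/
def Config.count (c : Config) (A : Set Plane) : ℕ := {i : Fin c.1 | c.2 i ∈ A}.ncard

/-- `Φ` is a homogeneous Poisson point process of density `lam` on the region `S` of finite area:
the number of points in a measurable set `A` is Poisson with mean `lam * area (A ∩ S)`, and the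
numbers of points in pairwise disjoint measurable sets are independent. Nothing is assumed on the
order in which the points are listed. -/
structure IsHomogeneousPPP {Ω : Type*} [MeasurableSpace Ω] (μ : Measure Ω) (Φ : Ω → Config)
    (lam : ℝ≥0) (S : Set Plane) : Prop where
  measurable : Measurable Φ
  map_count : ∀ A : Set Plane, MeasurableSet A →
    μ.map (fun ω => (Φ ω).count A) = poissonMeasure (lam * (volume (A ∩ S)).toNNReal)
  indep_count : ∀ (n : ℕ) (A : Fin n → Set Plane), (∀ i, MeasurableSet (A i)) →
    Pairwise (fun i j => Disjoint (A i) (A j)) → iIndepFun (fun i ω => (Φ ω).count (A i)) μ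

/-- The circularly symmetric complex Gaussian law with mean `m` and variance `v`: real and
imaginary parts are independent real Gaussians with variance `v / 2`. -/
def circularGaussian (m : ℂ) (v : ℝ≥0) : Measure ℂ :=
  ((gaussianReal m.re (v / 2)).prod (gaussianReal m.im (v / 2))).map
    (fun p => (⟨p.1, p.2⟩ : ℂ))

/-- The numerical parameters: path loss exponent `α`, transmit powers `PR` of a relay and `PJ` of
a jammer, SIR threshold `βe` of the eavesdroppers, radii `L₁`, `L₂` of the annulus, location `y` of
the destination, radius `LG` of its protected zone, and the densities of the relays, of the jammers
and of the eavesdroppers. -/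
structure Params where
  α : ℝ
  PR : ℝ
  PJ : ℝ
  βe : ℝ
  L₁ : ℝ
  L₂ : ℝ
  y : Plane
  LG : ℝ
  lamR : ℝ≥0
  lamJ : ℝ≥0
  lamE : ℝ≥0

/-- The standing assumptions on the parameters. -/
structure Params.Admissible (p : Params) : Prop where
  α_gt : 2 < p.α
  PR_pos : 0 < p.PR
  PJ_pos : 0 < p.PJ
  βe_pos : 0 < p.βe
  L₁_pos : 0 < p.L₁
  L₁_lt : p.L₁ < p.L₂
  LG_nonneg : 0 ≤ p.LG

/-- The region in which jammers are active: the annulus without the protected zone. -/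
def Params.jamRegion (p : Params) : Set Plane := annulus p.L₁ p.L₂ \ disk p.y p.LG

/-- The random elements of the network. Fading variables are attached to the listed points:
`Hy i` is the channel from the `i`-th relay to the destination, `Hz i k` the channel from the
`i`-th relay to the `k`-th eavesdropper and `h j k` the power fading from the `j`-th jammer to the
`k`-th eavesdropper. -/
structure Network (Ω : Type*) where
  relays : Ω → Config
  jammers : Ω → Config
  eaves : Ω → Config
  Hy : ℕ → Ω → ℂ
  Hz : ℕ → ℕ → Ω → ℂ
  h : ℕ → ℕ → Ω → ℝ

variable {Ω : Type*}

/-- The probabilistic model: relays, jammers and eavesdroppers are homogeneous Poisson point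
processes in the disk and in the annulus, the channels are i.i.d. `CN(0,1)` and the power fadings
i.i.d. `exp(1)`, and all these objects are mutually independent. -/
structure Network.IsModel [MeasurableSpace Ω] (N : Network Ω) (μ : Measure Ω) (p : Params) :
    Prop where
  relays_ppp : IsHomogeneousPPP μ N.relays p.lamR (disk 0 p.L₁)
  jammers_ppp : IsHomogeneousPPP μ N.jammers p.lamJ (annulus p.L₁ p.L₂)
  eaves_ppp : IsHomogeneousPPP μ N.eaves p.lamE (annulus p.L₁ p.L₂)
  measurable_Hy : ∀ i, Measurable (N.Hy i)
  measurable_Hz : ∀ i k, Measurable (N.Hz i k)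
  measurable_h : ∀ j k, Measurable (N.h j k)
  map_Hy : ∀ i, μ.map (N.Hy i) = circularGaussian 0 1
  map_Hz : ∀ i k, μ.map (N.Hz i k) = circularGaussian 0 1
  map_h : ∀ j k, μ.map (N.h j k) = expMeasure 1
  indep_Hy : iIndepFun N.Hy μ
  indep_Hz : iIndepFun (fun q : ℕ × ℕ => N.Hz q.1 q.2) μ
  indep_h : iIndepFun (fun q : ℕ × ℕ => N.h q.1 q.2) μ
  indep : iIndep
    ![MeasurableSpace.comap N.relays inferInstance,
      MeasurableSpace.comap N.jammers inferInstance,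
      MeasurableSpace.comap N.eaves inferInstance,
      MeasurableSpace.comap (fun ω (i : ℕ) => N.Hy i ω) inferInstance,
      MeasurableSpace.comap (fun ω (q : ℕ × ℕ) => N.Hz q.1 q.2 ω) inferInstance,
      MeasurableSpace.comap (fun ω (q : ℕ × ℕ) => N.h q.1 q.2 ω) inferInstance] μ

/-- The signal power `T(z)` at a receiver located at `z` that has the fading of the `k`-th
eavesdropper: each relay pre-compensates the phase of its channel to the destination. -/
def Network.signal (N : Network Ω) (p : Params) (k : ℕ) (z : Plane) (ω : Ω) : ℝ :=
  ‖∑ i : Fin (N.relays ω).1,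
      ((√p.PR : ℝ) : ℂ) * N.Hz i k ω * conj (N.Hy i ω) / ((‖N.Hy i ω‖ : ℝ) : ℂ) *
        ((dist ((N.relays ω).2 i) z ^ (-p.α / 2) : ℝ) : ℂ)‖ ^ 2

open Classical in
/-- The interference power `I(z)` at a receiver located at `z` that has the fading of the `k`-th
eavesdropper: the jammers in the protected zone of the destination keep silence. -/
def Network.interference (N : Network Ω) (p : Params) (k : ℕ) (z : Plane) (ω : Ω) : ℝ :=
  ∑ j : Fin (N.jammers ω).1,
    if (N.jammers ω).2 j ∈ disk p.y p.LG then 0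
    else p.PJ * N.h j k ω * dist ((N.jammers ω).2 j) z ^ (-p.α)

open Classical in
/-- The ratio `t / i` of two nonnegative numbers in `[0, ∞]`, with `t / 0 = ∞` for `t > 0`, and
with `c` as the value of `0 / 0`. -/
def ratio (c : ℝ≥0∞) (t i : ℝ) : ℝ≥0∞ :=
  if t = 0 ∧ i = 0 then c else ENNReal.ofReal t / ENNReal.ofReal i

/-- The signal-to-interference ratio `SIR_z` of a receiver located at `z` that has the fading of
the `k`-th eavesdropper; `c` is the convention for `0 / 0`. -/
def Network.SIR (N : Network Ω) (p : Params) (c : ℝ≥0∞) (k : ℕ) (z : Plane) (ω : Ω) : ℝ≥0∞ :=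
  ratio c (N.signal p k z ω) (N.interference p k z ω)

variable [MeasurableSpace Ω]

/-- The secrecy outage probability: the probability that the SIR achieved by some eavesdropper is
larger than the threshold. -/
def Network.SOP (N : Network Ω) (μ : Measure Ω) (p : Params) (c : ℝ≥0∞) : ℝ :=
  μ.real {ω | ∃ k : Fin (N.eaves ω).1,
    ENNReal.ofReal p.βe < N.SIR p c k ((N.eaves ω).2 k) ω}

/-- The conditional probability, given the locations of the relays and of the jammers, that the
SIR of a receiver located at the fixed point `z` is larger than the threshold. The receiver is given
the fading of index `0`; all indices have the same law, independent of the locations. -/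
def Network.condOutage (N : Network Ω) (μ : Measure Ω) (p : Params) (c : ℝ≥0∞) (z : Plane) :
    Ω → ℝ :=
  μ⟦{ω | ENNReal.ofReal p.βe < N.SIR p c 0 z ω} |
    MeasurableSpace.comap N.relays inferInstance ⊔ MeasurableSpace.comap N.jammers inferInstance⟧

/-- The upper bound before the expectation over the jammers is evaluated. -/
def Network.jensenBound (N : Network Ω) (μ : Measure Ω) (p : Params) (c : ℝ≥0∞) : ℝ :=
  1 - Real.exp (-(p.lamE : ℝ) *
    ∫ z in annulus p.L₁ p.L₂, ∫ ω, N.condOutage μ p c z ω ∂μ)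

/-- The upper bound after the expectation over the jammers is evaluated; the remaining expectation
is over the relays. -/
def Network.explicitBound (N : Network Ω) (μ : Measure Ω) (p : Params) : ℝ :=
  1 - Real.exp (-(p.lamE : ℝ) *
    ∫ z in annulus p.L₁ p.L₂, ∫ ω, Real.exp (-(p.lamJ : ℝ) *
      ∫ x in p.jamRegion,
        p.βe * p.PJ * dist x z ^ (-p.α) /
          ((∑ i : Fin (N.relays ω).1, p.PR * dist ((N.relays ω).2 i) z ^ (-p.α)) +
            p.βe * p.PJ * dist x z ^ (-p.α))) ∂μ)

end SecrecyOutage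

end

noncomputable section

namespace SecrecyOutage

/-! ### Measurability of functionals of configurations -/

/-! Fix the locations and the channels to the destination, all nonzero almost surely. Phase
pre-compensation multiplies each relay channel by a unimodular number, which preserves `CN(0,1)`.
The received amplitude is therefore circular Gaussian with variance `s = relayGain`, and for `s > 0`
the signal power is exponential with mean `s` (`signalOf_measure`, `circularGaussian_norm_sq_gt`).
The SIR then exceeds the threshold with probability `exp(-βe I / s)`. Averaging over the exponential
jammer fadings gives a product of factors `s / (s + w)`, with `w` the gain of a jammer. The result,
`outageOf`, depends only on the relays and the jammers (`fading_lt_ratio`).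

Different receivers use independent families of fading variables, so given the locations and the
channels to the destination their outage events are independent. Hence the outage probability is `1
- E ∏ (1 - outageOf)`, the product running over the eavesdroppers (`SOP_eq`). The probability
generating functional of a Poisson process (`IsHomogeneousPPP.integral_prod`) turns this into `1 - E
exp(-λe ∫ outageOf)`. Convexity of `exp` (Jensen) and Fubini give the first bound. The generating
functional of the jammers evaluates `E outageOf` when the convention for `0 / 0` exceeds the
threshold, which gives equality of the two bounds. Since `outageOf` is monotone in the convention,
the value `∞` dominates all others. -/

theorem Config.measurable_of_mk {β : Type*} [MeasurableSpace β] {f : Config → β}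
    (hf : ∀ n, Measurable fun v : Fin n → Plane => f ⟨n, v⟩) : Measurable f := by
  intro s hs
  -- The σ-algebra of a sigma type is the infimum of the pushforwards along `Sigma.mk n`, so
  -- measurability is tested for each fixed number of points.
  exact MeasurableSpace.measurableSet_iInf
    (m := fun n => (inferInstance : MeasurableSpace (Fin n → Plane)).map (Sigma.mk n)) |>.2
    fun n => hf n hs

/-- The `i`-th listed point, or `0` if there are not enough points. -/
def Config.get (c : Config) (i : ℕ) : Plane := if h : i < c.1 then c.2 ⟨i, h⟩ else 0

theorem Config.get_val (c : Config) (i : Fin c.1) : c.get i = c.2 i := by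
  simp [Config.get]

theorem Config.measurable_get (i : ℕ) : Measurable fun c : Config => c.get i := by
  refine Config.measurable_of_mk fun n => ?_
  by_cases h : i < n
  · simp only [Config.get, h, dite_true]
    exact measurable_pi_apply (⟨i, h⟩ : Fin n)
  · simp only [Config.get, h, dite_false]
    exact measurable_const

theorem Config.measurable_card : Measurable fun c : Config => c.1 :=
  Config.measurable_of_mk fun _ => measurable_const

/-- The index type `Fin c.1` varies with the configuration. Indexing by naturals removes this
dependence, both for measurability in `c` and for pairing points with sequences of fading variables.
-/
theorem Config.sum_eq_sum_range {M : Type*} [AddCommMonoid M] (c : Config) (f : ℕ → Plane → M) :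
    ∑ i : Fin c.1, f i (c.2 i) = ∑ i ∈ Finset.range c.1, f i (c.get i) := by
  simp [Finset.sum_range, Config.get_val]

theorem Config.prod_eq_prod_range {M : Type*} [CommMonoid M] (c : Config) (f : ℕ → Plane → M) :
    ∏ i : Fin c.1, f i (c.2 i) = ∏ i ∈ Finset.range c.1, f i (c.get i) := by
  simp [Finset.prod_range, Config.get_val]

theorem measurable_natIndexed {X β : Type*} [MeasurableSpace X] [MeasurableSpace β] {n : X → ℕ}
    (hn : Measurable n) {f : ℕ → X → β} (hf : ∀ i, Measurable (f i)) :
    Measurable fun x => f (n x) x :=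
  (measurable_from_prod_countable_right (f := fun q : ℕ × X => f q.1 q.2) hf).comp
    (hn.prodMk measurable_id)

theorem Config.measurable_sum {X M : Type*} [MeasurableSpace X] [AddCommMonoid M]
    [MeasurableSpace M] [MeasurableAdd₂ M] {c : X → Config} (hc : Measurable c)
    {f : ℕ → X → Plane → M} (hf : ∀ i, Measurable fun q : X × Plane => f i q.1 q.2) :
    Measurable fun x => ∑ i : Fin (c x).1, f i x ((c x).2 i) := by
  simp_rw [fun x => Config.sum_eq_sum_range (c x) (fun i => f i x)]
  refine measurable_natIndexed (Config.measurable_card.comp hc)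
    (f := fun n x => ∑ i ∈ Finset.range n, f i x ((c x).get i)) fun n => ?_
  exact Finset.measurable_fun_sum _ fun i _ =>
    (hf i).comp (measurable_id.prodMk ((Config.measurable_get i).comp hc))

theorem Config.measurable_prod {X M : Type*} [MeasurableSpace X] [CommMonoid M]
    [MeasurableSpace M] [MeasurableMul₂ M] {c : X → Config} (hc : Measurable c)
    {f : ℕ → X → Plane → M} (hf : ∀ i, Measurable fun q : X × Plane => f i q.1 q.2) :
    Measurable fun x => ∏ i : Fin (c x).1, f i x ((c x).2 i) := by
  simp_rw [fun x => Config.prod_eq_prod_range (c x) (fun i => f i x)]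
  refine measurable_natIndexed (Config.measurable_card.comp hc)
    (f := fun n x => ∏ i ∈ Finset.range n, f i x ((c x).get i)) fun n => ?_
  exact Finset.measurable_fun_prod _ fun i _ =>
    (hf i).comp (measurable_id.prodMk ((Config.measurable_get i).comp hc))

/-! ### The probability generating functional of a Poisson point process -/

theorem integral_pow_poissonMeasure (r : ℝ≥0) (a : ℝ) :
    ∫ n, a ^ n ∂(poissonMeasure r) = Real.exp (-(r * (1 - a))) := by
  rw [integral_poissonMeasure]
  have h := (NormedSpace.expSeries_div_hasSum_exp ((r : ℝ) * a)).mul_left (Real.exp (-r))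
  rw [← Real.exp_eq_exp_ℝ, ← Real.exp_add] at h
  rw [show -((r : ℝ) * (1 - a)) = -r + r * a by ring, ← h.tsum_eq]
  congr with n
  rw [mul_pow, smul_eq_mul]
  ring

/-- Grouping the points by their colour `κ` leaves only counts, the sole quantities that the
definition of a Poisson process controls. -/
theorem Config.prod_comp_eq_prod_count {K : ℕ} (c : Config) (κ : Plane → Fin K) (a : Fin K → ℝ) :
    ∏ i, a (κ (c.2 i)) = ∏ k, a k ^ c.count (κ ⁻¹' {k}) := by
  rw [← Finset.prod_fiberwise' Finset.univ (fun i => κ (c.2 i)) a]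
  refine Finset.prod_congr rfl fun k _ => ?_
  rw [Finset.prod_const, Config.count, ← Set.ncard_coe_finset]
  congr 2
  ext i
  simp

theorem Config.measurable_count {A : Set Plane} (hA : MeasurableSet A) :
    Measurable fun c : Config => c.count A := by
  classical
  have h : (fun c : Config => c.count A) = fun c => ∑ i : Fin c.1, A.indicator 1 (c.2 i) := by
    ext c
    simp [Config.count, Set.indicator_apply, Set.ncard_eq_toFinset_card']
  rw [h]
  exact Config.measurable_sum measurable_id (f := fun _ _ x => A.indicator 1 x)
    fun i => (measurable_one.indicator hA).comp measurable_snd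

section PoissonPointProcess

variable {Ω : Type*} [MeasurableSpace Ω]

/-- This is the generating functional for functions with finitely many values: the counts in the
colour classes are independent Poisson variables, and each contributes its generating function. -/
theorem IsHomogeneousPPP.integral_prod_comp {μ : Measure Ω} [IsProbabilityMeasure μ]
    {Φ : Ω → Config} {lam : ℝ≥0} {S : Set Plane} (h : IsHomogeneousPPP μ Φ lam S)
    (hSfin : volume S ≠ ∞) {K : ℕ} {κ : Plane → Fin K} (hκ : Measurable κ) (a : Fin K → ℝ) :
    ∫ ω, ∏ i, a (κ ((Φ ω).2 i)) ∂μ = Real.exp (-(lam * ∫ x in S, (1 - a (κ x)))) := by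
  have hA : ∀ k, MeasurableSet (κ ⁻¹' {k}) := fun k => hκ (measurableSet_singleton k)
  have hc : ∀ k, Measurable fun ω => (Φ ω).count (κ ⁻¹' {k}) := fun k =>
    (Config.measurable_count (hA k)).comp h.measurable
  simp_rw [Config.prod_comp_eq_prod_count]
  have hdisj : Pairwise fun i j => Disjoint (κ ⁻¹' {i}) (κ ⁻¹' {j}) := fun i j hij =>
    Disjoint.preimage κ (Set.disjoint_singleton.2 hij)
  have hind := h.indep_count K (fun k => κ ⁻¹' {k}) hA hdisj
  have hind2 := hind.comp (fun k (n : ℕ) => a k ^ n) fun k => measurable_from_nat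
  have hprod := hind2.integral_fun_prod_eq_prod_integral
    (fun k => ((measurable_from_nat (f := fun n : ℕ => a k ^ n)).comp (hc k)).aestronglyMeasurable)
  refine hprod.trans ?_
  have hone : ∀ k, ∫ ω, ((fun n : ℕ => a k ^ n) ∘ fun ω => (Φ ω).count (κ ⁻¹' {k})) ω ∂μ =
      Real.exp (-(lam * (volume.real (κ ⁻¹' {k} ∩ S) * (1 - a k)))) := by
    intro k
    have hm := integral_map (μ := μ) (hc k).aemeasurable (f := fun n : ℕ => a k ^ n)
      measurable_from_nat.aestronglyMeasurable
    refine hm.symm.trans ?_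
    rw [h.map_count _ (hA k), integral_pow_poissonMeasure]
    simp only [NNReal.coe_mul, ENNReal.coe_toNNReal_eq_toReal, measureReal_def]
    rw [mul_assoc]
  rw [Finset.prod_congr rfl fun k _ => hone k, ← Real.exp_sum, Finset.sum_neg_distrib,
    ← Finset.mul_sum]
  have : IsFiniteMeasure (volume.restrict S) := ⟨by simpa using hSfin.lt_top⟩
  rw [← integral_map (μ := volume.restrict S) hκ.aemeasurable (f := fun k => 1 - a k)
    (measurable_of_finite _).aestronglyMeasurable, integral_fintype (Integrable.of_finite)]
  congr 4 with k
  rw [map_measureReal_apply hκ (measurableSet_singleton k), measureReal_restrict_apply (hA k),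
    smul_eq_mul]

/-- The probability generating functional of a homogeneous Poisson point process. -/
theorem IsHomogeneousPPP.integral_prod {μ : Measure Ω} [IsProbabilityMeasure μ]
    {Φ : Ω → Config} {lam : ℝ≥0} {S : Set Plane} (h : IsHomogeneousPPP μ Φ lam S)
    (hSfin : volume S ≠ ∞) {f : Plane → ℝ} (hf : Measurable f) (hf0 : ∀ x, 0 ≤ f x)
    (hf1 : ∀ x, f x ≤ 1) :
    ∫ ω, ∏ i, f ((Φ ω).2 i) ∂μ = Real.exp (-(lam * ∫ x in S, (1 - f x))) := by
  have : IsFiniteMeasure (volume.restrict S) := ⟨by simpa using hSfin.lt_top⟩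
  -- Rounding `f` down to multiples of `1 / m` gives functions with at most `m + 1` values that
  -- converge pointwise to `f`. All integrands stay in `[0, 1]`, so dominated convergence applies to
  -- both sides of the finite-valued formula.
  let g : ℕ → Plane → ℝ := fun m x => (⌊f x * m⌋₊ : ℝ) / m
  have hgm : ∀ m, Measurable (g m) := fun m => by fun_prop
  have hg0 : ∀ m x, 0 ≤ g m x := fun m x => by positivity
  have hg1 : ∀ m x, g m x ≤ 1 := fun m x => by
    refine div_le_one_of_le₀ ?_ (by positivity)
    exact (Nat.floor_le (by have := hf0 x; positivity)).trans
      (mul_le_of_le_one_left (by positivity) (hf1 x))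
  have hglim : ∀ x, Filter.Tendsto (fun m => g m x) Filter.atTop (nhds (f x)) := fun x =>
    (tendsto_nat_floor_mul_div_atTop (hf0 x)).comp tendsto_natCast_atTop_atTop
  have hstep : ∀ m, ∫ ω, ∏ i, g m ((Φ ω).2 i) ∂μ =
      Real.exp (-(lam * ∫ x in S, (1 - g m x))) := by
    intro m
    have hlt : ∀ x, ⌊f x * m⌋₊ < m + 1 := fun x => by
      refine Nat.lt_succ_of_le (Nat.floor_le_of_le ?_)
      exact mul_le_of_le_one_left (by positivity) (hf1 x)
    have hκ : Measurable fun x => (⟨⌊f x * m⌋₊, hlt x⟩ : Fin (m + 1)) :=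
      measurable_to_countable' fun k => by
        have e : (fun x => (⟨⌊f x * m⌋₊, hlt x⟩ : Fin (m + 1))) ⁻¹' {k} =
            (fun x => ⌊f x * m⌋₊) ⁻¹' {(k : ℕ)} := by
          ext x
          simp [Fin.ext_iff]
        rw [e]
        exact Nat.measurable_floor.comp (hf.mul_const _) (measurableSet_singleton _)
    exact h.integral_prod_comp hSfin hκ fun k => (k : ℝ) / m
  have hl : Filter.Tendsto (fun m => ∫ ω, ∏ i, g m ((Φ ω).2 i) ∂μ) Filter.atTop
      (nhds (∫ ω, ∏ i, f ((Φ ω).2 i) ∂μ)) := by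
    refine tendsto_integral_of_dominated_convergence (fun _ => 1) (fun m => ?_)
      (integrable_const _) (fun m => Filter.Eventually.of_forall fun ω => ?_)
      (Filter.Eventually.of_forall fun ω => tendsto_finsetProd _ fun i _ => hglim _)
    · exact (Config.measurable_prod h.measurable (f := fun _ _ x => g m x)
        fun _ => (hgm m).comp measurable_snd).aestronglyMeasurable
    · rw [Real.norm_of_nonneg (Finset.prod_nonneg fun i _ => hg0 m _)]
      exact Finset.prod_le_one (fun i _ => hg0 m _) fun i _ => hg1 m _
  have hr : Filter.Tendsto (fun m => Real.exp (-(lam * ∫ x in S, (1 - g m x)))) Filter.atTop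
      (nhds (Real.exp (-(lam * ∫ x in S, (1 - f x))))) := by
    refine (Real.continuous_exp.tendsto _).comp ((Filter.Tendsto.const_mul _ ?_).neg)
    refine tendsto_integral_of_dominated_convergence (fun _ => 1) (fun m => ?_)
      (integrable_const _) (fun m => Filter.Eventually.of_forall fun x => ?_)
      (Filter.Eventually.of_forall fun x => (hglim x).const_sub 1)
    · exact (measurable_const.sub (hgm m)).aestronglyMeasurable
    · rw [Real.norm_of_nonneg (sub_nonneg.2 (hg1 m x))]
      linarith [hg0 m x]
  exact tendsto_nhds_unique hl (hr.congr fun m => (hstep m).symm)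

theorem volume_annulus_ne_top (L₁ L₂ : ℝ) : volume (annulus L₁ L₂) ≠ ∞ := by
  refine ((measure_mono fun x hx => ?_).trans_lt
    (measure_closedBall_lt_top (x := (0 : Plane)) (r := L₂))).ne
  simpa using hx.2

end PoissonPointProcess

/-! ### Circularly symmetric Gaussian laws -/

theorem measurable_complex_mk : Measurable fun q : ℝ × ℝ => (⟨q.1, q.2⟩ : ℂ) :=
  Complex.measurableEquivRealProd.symm.measurable

instance (m : ℂ) (v : ℝ≥0) : IsProbabilityMeasure (circularGaussian m v) :=
  Measure.isProbabilityMeasure_map measurable_complex_mk.aemeasurable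

/-- Real and imaginary parts are independent with variance `v / 2`, so the exponents `-(v / 2) t.re
^ 2 / 2` and `-(v / 2) t.im ^ 2 / 2` add up to a function of `‖t‖` alone. -/
theorem charFun_circularGaussian (v : ℝ≥0) (t : ℂ) :
    charFun (circularGaussian 0 v) t = Complex.exp (-((v : ℂ) * (‖t‖ : ℂ) ^ 2 / 4)) := by
  rw [charFun_apply, circularGaussian, integral_map measurable_complex_mk.aemeasurable
    (by fun_prop)]
  have h : ∀ q : ℝ × ℝ, Complex.exp ((inner ℝ (⟨q.1, q.2⟩ : ℂ) t : ℝ) * Complex.I) =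
      Complex.exp (t.re * q.1 * Complex.I) * Complex.exp (t.im * q.2 * Complex.I) := by
    intro q
    rw [← Complex.exp_add, Complex.inner]
    congr 1
    simp
    ring
  simp_rw [h]
  rw [integral_prod_mul (fun x : ℝ => Complex.exp (t.re * x * Complex.I))
    (fun x : ℝ => Complex.exp (t.im * x * Complex.I)), ← charFun_apply_real, ← charFun_apply_real,
    charFun_gaussianReal, charFun_gaussianReal, ← Complex.exp_add]
  congr 1
  have : (‖t‖ : ℂ) ^ 2 = (t.re : ℂ) ^ 2 + (t.im : ℂ) ^ 2 := by
    rw [← Complex.ofReal_pow, ← Complex.normSq_eq_norm_sq, Complex.normSq_apply]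
    push_cast
    ring
  rw [this]
  push_cast
  simp
  ring

/-- Characteristic functions of independent terms multiply, and that of a circular Gaussian sees
only the modulus of its argument: the phases of the coefficients disappear and the variances `‖a i‖
^ 2` add. -/
theorem map_sum_mul_circularGaussian (n : ℕ) (a : ℕ → ℂ) :
    (Measure.infinitePi fun _ : ℕ => circularGaussian 0 1).map
      (fun x => ∑ i ∈ Finset.range n, a i * x i) =
      circularGaussian 0 (∑ i ∈ Finset.range n, ‖a i‖₊ ^ 2) := by
  set P := Measure.infinitePi fun _ : ℕ => circularGaussian 0 1
  have hm : Measurable fun x : ℕ → ℂ => ∑ i ∈ Finset.range n, a i * x i := by fun_prop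
  have : IsProbabilityMeasure (P.map fun x => ∑ i ∈ Finset.range n, a i * x i) :=
    Measure.isProbabilityMeasure_map hm.aemeasurable
  have hind : iIndepFun (fun i (x : ℕ → ℂ) => a i * x i) P :=
    iIndepFun_infinitePi (P := fun _ : ℕ => circularGaussian 0 1) (X := fun i z => a i * z)
      (by fun_prop)
  have hmi : ∀ i, Measurable fun x : ℕ → ℂ => a i * x i := fun i => by fun_prop
  refine Measure.ext_of_charFun (funext fun t => ?_)
  rw [iIndepFun.charFun_map_fun_finsetSum_eq_prod (X := fun i (x : ℕ → ℂ) => a i * x i)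
    (fun i _ => (hmi i).aemeasurable) (hind.restrict _),
    Finset.prod_apply]
  have key : ∀ i, charFun (P.map fun x : ℕ → ℂ => a i * x i) t =
      Complex.exp (-((‖a i‖ : ℂ) ^ 2 * (‖t‖ : ℂ) ^ 2 / 4)) := by
    intro i
    have e : (fun x : ℕ → ℂ => a i * x i) = (fun z : ℂ => a i * z) ∘ (fun x : ℕ → ℂ => x i) := rfl
    rw [e, ← Measure.map_map (by fun_prop) (by fun_prop), Measure.infinitePi_map_eval]
    -- For the real inner product on `ℂ`, the adjoint of multiplication by `a i` is multiplication
    -- by its conjugate.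
    have h2 : charFun ((circularGaussian 0 1).map fun z : ℂ => a i * z) t =
        charFun (circularGaussian 0 1) (conj (a i) * t) := by
      rw [charFun_apply, charFun_apply, integral_map (by fun_prop) (by fun_prop)]
      congr with z
      congr 3
      simp only [Complex.inner, map_mul]
      congr 1
      ring
    rw [h2, charFun_circularGaussian]
    congr 1
    simp
    ring
  simp_rw [key]
  rw [charFun_circularGaussian, ← Complex.exp_sum]
  congr 1
  push_cast
  rw [Finset.sum_neg_distrib, ← Finset.sum_div, ← Finset.sum_mul]

theorem circularGaussian_zero : circularGaussian 0 0 = Measure.dirac 0 := by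
  refine Measure.ext_of_charFun (funext fun t => ?_)
  rw [charFun_circularGaussian, charFun_dirac]
  simp

theorem integral_Ioi_mul_exp_neg_sq {v b : ℝ} (hv : 0 < v) (hb : 0 ≤ b) :
    ∫⁻ r in Set.Ioi b, ENNReal.ofReal (2 * r / v * Real.exp (-r ^ 2 / v)) =
      ENNReal.ofReal (Real.exp (-b ^ 2 / v)) := by
  have hd : ∀ x : ℝ, HasDerivAt (fun r => -Real.exp (-r ^ 2 / v))
      (2 * x / v * Real.exp (-x ^ 2 / v)) x := by
    intro x
    have h1 : HasDerivAt (fun r : ℝ => -r ^ 2 / v) (-(2 * x) / v) x := by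
      simpa using ((hasDerivAt_pow 2 x).neg.div_const v)
    exact h1.exp.neg.congr_deriv (by ring)
  have ht : Filter.Tendsto (fun r => -Real.exp (-r ^ 2 / v)) Filter.atTop (nhds 0) := by
    rw [← neg_zero]
    refine (Real.tendsto_exp_atBot.comp ?_).neg
    have : Filter.Tendsto (fun r : ℝ => r ^ 2 / v) Filter.atTop Filter.atTop :=
      (Filter.tendsto_pow_atTop two_ne_zero).atTop_div_const hv
    refine (Filter.tendsto_neg_atTop_atBot.comp this).congr fun r => ?_
    simp [neg_div]
  have hnn : ∀ x ∈ Set.Ioi b, 0 ≤ 2 * x / v * Real.exp (-x ^ 2 / v) := fun x hx => by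
    have : 0 ≤ x := hb.trans (le_of_lt hx)
    positivity
  rw [← ofReal_integral_eq_lintegral_ofReal
    (integrableOn_Ioi_deriv_of_nonneg' (fun x _ => hd x) hnn ht)
    ((ae_restrict_iff' measurableSet_Ioi).2 (Filter.Eventually.of_forall hnn)),
    integral_Ioi_of_hasDerivAt_of_nonneg' (fun x _ => hd x) hnn ht]
  simp

/-- The squared modulus is exponential with mean `v`: in polar coordinates the density does not
depend on the angle, and the radial part is an exact derivative. Positive variance is needed for a
density to exist. -/
theorem circularGaussian_norm_sq_gt {v : ℝ≥0} (hv : v ≠ 0) {t : ℝ} (ht : 0 ≤ t) :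
    circularGaussian 0 v {w | t < ‖w‖ ^ 2} = ENNReal.ofReal (Real.exp (-(t / v))) := by
  have hv0 : (0 : ℝ) < v := by positivity
  have hv2 : v / 2 ≠ 0 := by simpa using hv
  have hS : MeasurableSet {w : ℂ | t < ‖w‖ ^ 2} :=
    measurableSet_lt measurable_const (by fun_prop)
  rw [circularGaussian, Measure.map_apply measurable_complex_mk hS, gaussianReal_of_var_ne_zero _ hv2,
    gaussianReal_of_var_ne_zero _ hv2, prod_withDensity (by fun_prop) (by fun_prop),
    withDensity_apply _ (measurable_complex_mk hS), ← lintegral_indicator (measurable_complex_mk hS),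
    ← Measure.volume_eq_prod, ← lintegral_comp_polarCoord_symm]
  have e : ∀ q ∈ polarCoord.target, ENNReal.ofReal q.1 •
      ((fun q : ℝ × ℝ => (⟨q.1, q.2⟩ : ℂ)) ⁻¹' {w | t < ‖w‖ ^ 2}).indicator
        (fun z => gaussianPDF (0 : ℂ).re (v / 2) z.1 * gaussianPDF (0 : ℂ).im (v / 2) z.2)
        (polarCoord.symm q) =
      (Set.Ioi (√t)).indicator (fun r => ENNReal.ofReal
        (2 * r / v * Real.exp (-r ^ 2 / v))) q.1 * ENNReal.ofReal ((2 * Real.pi)⁻¹) := by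
    rintro ⟨r, θ⟩ hq
    have hr : 0 < r := by simpa [polarCoord] using hq.1
    have hn : ‖(⟨r * Real.cos θ, r * Real.sin θ⟩ : ℂ)‖ ^ 2 = r ^ 2 := by
      rw [← Complex.normSq_eq_norm_sq, Complex.normSq_apply]
      nlinarith [Real.sin_sq_add_cos_sq θ]
    have hmem : (polarCoord.symm (r, θ) ∈
        (fun q : ℝ × ℝ => (⟨q.1, q.2⟩ : ℂ)) ⁻¹' {w | t < ‖w‖ ^ 2}) ↔ r ∈ Set.Ioi (√t) := by
      simp only [polarCoord_symm_apply, Set.mem_preimage, Set.mem_ofPred_eq, Set.mem_Ioi, hn]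
      rw [Real.sqrt_lt' hr]
    by_cases hrt : r ∈ Set.Ioi (√t)
    · rw [Set.indicator_of_mem (hmem.2 hrt), Set.indicator_of_mem hrt]
      simp only [polarCoord_symm_apply, gaussianPDF, gaussianPDFReal, smul_eq_mul]
      rw [← ENNReal.ofReal_mul (by positivity), ← ENNReal.ofReal_mul (by positivity),
        ← ENNReal.ofReal_mul (by positivity)]
      congr 1
      have h2 : 2 * Real.pi * ((v / 2 : ℝ≥0) : ℝ) = Real.pi * v := by
        push_cast; ring
      have h3 : Real.exp (-(r * Real.cos θ - (0 : ℂ).re) ^ 2 / (2 * ((v / 2 : ℝ≥0) : ℝ))) *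
          Real.exp (-(r * Real.sin θ - (0 : ℂ).im) ^ 2 / (2 * ((v / 2 : ℝ≥0) : ℝ))) =
          Real.exp (-r ^ 2 / v) := by
        rw [← Real.exp_add]
        congr 1
        push_cast
        simp only [Complex.zero_re, Complex.zero_im]
        field_simp
        nlinarith [Real.sin_sq_add_cos_sq θ]
      have h4 : (√(Real.pi * v))⁻¹ * (√(Real.pi * v))⁻¹ = (Real.pi * v)⁻¹ := by
        rw [← mul_inv, Real.mul_self_sqrt (by positivity)]
      rw [h2, show ∀ x y z w : ℝ, r * (x * y * (z * w)) = r * ((x * z) * (y * w)) by intros; ring,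
        h3, h4]
      field_simp
    · rw [Set.indicator_of_notMem (fun h => hrt (hmem.1 h)), Set.indicator_of_notMem hrt]
      simp
  rw [setLIntegral_congr_fun polarCoord.open_target.measurableSet e, polarCoord_target,
    Measure.volume_eq_prod, ← Measure.prod_restrict,
    lintegral_prod_mul (f := (Set.Ioi (√t)).indicator fun r => ENNReal.ofReal
      (2 * r / v * Real.exp (-r ^ 2 / v))) (g := fun _ => ENNReal.ofReal ((2 * Real.pi)⁻¹))]
  · rw [lintegral_indicator measurableSet_Ioi, Measure.restrict_restrict measurableSet_Ioi,
      Set.inter_eq_left.2 (Set.Ioi_subset_Ioi (Real.sqrt_nonneg t)),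
      integral_Ioi_mul_exp_neg_sq hv0 (Real.sqrt_nonneg t), lintegral_const,
      Measure.restrict_apply_univ, Real.volume_Ioo, ← ENNReal.ofReal_mul (by positivity),
      show Real.pi - -Real.pi = 2 * Real.pi by ring, inv_mul_cancel₀ (by positivity),
      Real.sq_sqrt ht]
    simp [neg_div]
  · exact (Measurable.indicator (by fun_prop) measurableSet_Ioi).aemeasurable
  · fun_prop

/-! ### The Laplace transform of the exponential law -/

instance : IsProbabilityMeasure (expMeasure 1) := isProbabilityMeasure_expMeasure one_pos

/-- Dropping the null point `0` from the support makes almost sure strict positivity of the fadings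
immediate. -/
theorem expMeasure_one_eq : expMeasure 1 =
    (volume.restrict (Set.Ioi 0)).withDensity fun x => ENNReal.ofReal (Real.exp (-x)) := by
  have h : exponentialPDF 1 =
      (Set.Ici 0).indicator fun x => ENNReal.ofReal (Real.exp (-x)) := by
    ext x
    rw [exponentialPDF_eq]
    by_cases hx : 0 ≤ x <;> simp [hx]
  change volume.withDensity (exponentialPDF 1) = _
  rw [h, withDensity_indicator measurableSet_Ici, Measure.restrict_congr_set Ioi_ae_eq_Ici]

theorem ae_pos_expMeasure_one : ∀ᵐ x ∂(expMeasure 1), 0 < x := by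
  rw [expMeasure_one_eq]
  exact (withDensity_absolutelyContinuous _ _).ae_le (ae_restrict_mem measurableSet_Ioi)

theorem lintegral_exp_neg_mul_expMeasure_one {u : ℝ} (hu : 0 ≤ u) :
    ∫⁻ x, ENNReal.ofReal (Real.exp (-(u * x))) ∂(expMeasure 1) = ENNReal.ofReal (1 + u)⁻¹ := by
  rw [expMeasure_one_eq, lintegral_withDensity_eq_lintegral_mul _ (by fun_prop) (by fun_prop)]
  have h : (fun x : ℝ => ENNReal.ofReal (Real.exp (-x)) * ENNReal.ofReal (Real.exp (-(u * x)))) =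
      fun x => ENNReal.ofReal (Real.exp (-(1 + u) * x)) := by
    ext x
    rw [← ENNReal.ofReal_mul (by positivity), ← Real.exp_add]
    congr 2
    ring
  change ∫⁻ x in Set.Ioi 0, (fun x : ℝ => ENNReal.ofReal (Real.exp (-x)) *
    ENNReal.ofReal (Real.exp (-(u * x)))) x = _
  rw [h, ← ofReal_integral_eq_lintegral_ofReal
    (integrableOn_exp_mul_Ioi (by linarith) 0) (Filter.Eventually.of_forall fun _ => by positivity),
    integral_exp_mul_Ioi (by linarith)]
  rw [mul_zero, Real.exp_zero, neg_div_neg_eq, one_div]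

/-! ### The conditional outage probability given the locations -/

/-- The signal power as a function of the relays and of the fading variables. -/
def signalOf (p : Params) (r : Config) (hy hz : ℕ → ℂ) (z : Plane) : ℝ :=
  ‖∑ i : Fin r.1, ((√p.PR : ℝ) : ℂ) * hz i * conj (hy i) / ((‖hy i‖ : ℝ) : ℂ) *
    ((dist (r.2 i) z ^ (-p.α / 2) : ℝ) : ℂ)‖ ^ 2

open Classical in
/-- The interference power as a function of the jammers and of the fading variables. -/
def interferenceOf (p : Params) (j : Config) (h : ℕ → ℝ) (z : Plane) : ℝ :=
  ∑ i : Fin j.1, if j.2 i ∈ disk p.y p.LG then 0 else p.PJ * h i * dist (j.2 i) z ^ (-p.α)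

/-- The mean of the signal power given the relays. -/
def relayGain (p : Params) (r : Config) (z : Plane) : ℝ :=
  ∑ i : Fin r.1, p.PR * dist (r.2 i) z ^ (-p.α)

open Classical in
/-- The mean interference power, times the threshold, of a jammer at `x`. -/
def jamGain (p : Params) (x z : Plane) : ℝ :=
  if x ∈ disk p.y p.LG then 0 else p.βe * p.PJ * dist x z ^ (-p.α)

open Classical in
/-- The factor by which one jammer with gain `w` reduces the outage probability when the mean
signal power is `s`. -/
def jamFactor (s w : ℝ) : ℝ := if w = 0 then 1 else s / (s + w)

open Classical in
/-- The conditional outage probability at `z` given the relays and the jammers. -/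
def outageOf (p : Params) (c : ℝ≥0∞) (r j : Config) (z : Plane) : ℝ :=
  (if relayGain p r z = 0 ∧ ¬ ENNReal.ofReal p.βe < c then 0 else 1) *
    ∏ i, jamFactor (relayGain p r z) (jamGain p (j.2 i) z)

theorem Params.Admissible.relayGain_nonneg {p : Params} (hp : p.Admissible) (r : Config)
    (z : Plane) : 0 ≤ relayGain p r z :=
  Finset.sum_nonneg fun _ _ => mul_nonneg hp.PR_pos.le (Real.rpow_nonneg dist_nonneg _)

theorem Params.Admissible.jamGain_nonneg {p : Params} (hp : p.Admissible) (x z : Plane) :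
    0 ≤ jamGain p x z := by
  rw [jamGain]
  split_ifs
  · exact le_rfl
  · exact mul_nonneg (mul_pos hp.βe_pos hp.PJ_pos).le (Real.rpow_nonneg dist_nonneg _)

theorem jamFactor_nonneg {s w : ℝ} (hs : 0 ≤ s) (hw : 0 ≤ w) : 0 ≤ jamFactor s w := by
  rw [jamFactor]
  split_ifs <;> positivity

theorem jamFactor_le_one {s w : ℝ} (hs : 0 ≤ s) (hw : 0 ≤ w) : jamFactor s w ≤ 1 := by
  rw [jamFactor]
  split_ifs
  · exact le_rfl
  · exact div_le_one_of_le₀ (by linarith) (by positivity)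

theorem jamFactor_of_pos {s w : ℝ} (hs : 0 < s) : jamFactor s w = (1 + w / s)⁻¹ := by
  rw [jamFactor]
  split_ifs with h
  · simp [h]
  · rw [one_add_div hs.ne', inv_div]

theorem Params.Admissible.outageOf_nonneg {p : Params} (hp : p.Admissible) (c : ℝ≥0∞)
    (r j : Config) (z : Plane) : 0 ≤ outageOf p c r j z :=
  mul_nonneg (by split_ifs <;> simp) (Finset.prod_nonneg fun _ _ =>
    jamFactor_nonneg (hp.relayGain_nonneg r z) (hp.jamGain_nonneg _ z))

theorem Params.Admissible.outageOf_le_one {p : Params} (hp : p.Admissible) (c : ℝ≥0∞)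
    (r j : Config) (z : Plane) : outageOf p c r j z ≤ 1 :=
  mul_le_one₀ (by split_ifs <;> simp) (Finset.prod_nonneg fun _ _ =>
    jamFactor_nonneg (hp.relayGain_nonneg r z) (hp.jamGain_nonneg _ z))
    (Finset.prod_le_one (fun _ _ =>
      jamFactor_nonneg (hp.relayGain_nonneg r z) (hp.jamGain_nonneg _ z)) fun _ _ =>
      jamFactor_le_one (hp.relayGain_nonneg r z) (hp.jamGain_nonneg _ z))

open Classical in
theorem lt_ratio_iff (c : ℝ≥0∞) {b t i : ℝ} (hb : 0 < b) (ht : 0 ≤ t) (hi : 0 ≤ i) :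
    ENNReal.ofReal b < ratio c t i ↔
      if t = 0 ∧ i = 0 then ENNReal.ofReal b < c else b * i < t := by
  rw [ratio]
  split_ifs with h
  · rfl
  · rcases hi.eq_or_lt with rfl | hi
    · have ht : 0 < t := lt_of_le_of_ne ht fun h' => h ⟨h'.symm, rfl⟩
      simp [ENNReal.div_zero (ENNReal.ofReal_pos.2 ht).ne', ht]
    · rw [ENNReal.lt_div_iff_mul_lt (Or.inl (ENNReal.ofReal_pos.2 hi).ne')
        (Or.inl ENNReal.ofReal_ne_top), ← ENNReal.ofReal_mul hb.le,
        ENNReal.ofReal_lt_ofReal_iff_of_nonneg (by positivity)]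

theorem Measurable.ratio {X : Type*} [MeasurableSpace X] (c : ℝ≥0∞) {f g : X → ℝ}
    (hf : Measurable f) (hg : Measurable g) : Measurable fun x => ratio c (f x) (g x) := by
  classical
  refine Measurable.ite ?_ measurable_const (by fun_prop)
  exact (hf (measurableSet_singleton 0)).inter (hg (measurableSet_singleton 0))

open Classical in
-- For `v ≠ 0` the signal is almost surely positive, so the convention for `0 / 0` is irrelevant.
-- For `v = 0` the signal vanishes and only `0 / 0` can exceed the threshold.
theorem circularGaussian_lt_ratio (c : ℝ≥0∞) {b i : ℝ} (hb : 0 < b) (hi : 0 ≤ i) (v : ℝ≥0) :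
    circularGaussian 0 v {w | ENNReal.ofReal b < ratio c (‖w‖ ^ 2) i} =
      if v = 0 then (if i = 0 ∧ ENNReal.ofReal b < c then 1 else 0)
      else ENNReal.ofReal (Real.exp (-(b * i / v))) := by
  have hset : {w : ℂ | ENNReal.ofReal b < ratio c (‖w‖ ^ 2) i} =
      {w | if ‖w‖ ^ 2 = 0 ∧ i = 0 then ENNReal.ofReal b < c else b * i < ‖w‖ ^ 2} := by
    ext w
    exact lt_ratio_iff c hb (by positivity) hi
  have hm : MeasurableSet {w : ℂ | ENNReal.ofReal b < ratio c (‖w‖ ^ 2) i} :=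
    measurableSet_lt measurable_const (Measurable.ratio c (by fun_prop) (by fun_prop))
  split_ifs with hv h
  · rw [hv, circularGaussian_zero, Measure.dirac_apply' _ hm, hset]
    simp [h]
  · rw [hv, circularGaussian_zero, Measure.dirac_apply' _ hm, hset]
    rcases hi.eq_or_lt with rfl | hi
    · simpa using h
    · have : ¬ b * i < 0 := by nlinarith
      simp [hi.ne', this]
  · rw [← circularGaussian_norm_sq_gt hv (t := b * i) (by positivity)]
    refine measure_congr ?_
    have h0 : ∀ᵐ w ∂(circularGaussian 0 v), 0 < ‖w‖ ^ 2 := by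
      have h1 := circularGaussian_norm_sq_gt hv (t := 0) le_rfl
      rw [zero_div, neg_zero, Real.exp_zero, ENNReal.ofReal_one] at h1
      exact (prob_compl_eq_zero_iff (measurableSet_lt measurable_const (by fun_prop))).2 h1
    rw [hset]
    filter_upwards [h0] with w hw
    refine propext ?_
    change (if ‖w‖ ^ 2 = 0 ∧ i = 0 then ENNReal.ofReal b < c else b * i < ‖w‖ ^ 2) ↔ _
    rw [if_neg fun h => hw.ne' h.1]
    rfl

/-- The signal is a linear combination of the `hz i` whose coefficients have squared modulus `PR *
dist ^ (-α)`, whatever the phases of the `hy i`. Nonvanishing of `hy i` matters: otherwise the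
quotient by its norm would be `0` and the relay would be lost. -/
theorem signalOf_measure (p : Params) (hp : p.Admissible) (r : Config) (z : Plane) {hy : ℕ → ℂ}
    (hhy : ∀ i, hy i ≠ 0) {A : Set ℝ} (hA : MeasurableSet A) :
    (Measure.infinitePi fun _ : ℕ => circularGaussian 0 1) {hz | signalOf p r hy hz z ∈ A} =
      circularGaussian 0 (relayGain p r z).toNNReal {w | ‖w‖ ^ 2 ∈ A} := by
  let a : ℕ → ℂ := fun i => ((√p.PR : ℝ) : ℂ) * conj (hy i) / ((‖hy i‖ : ℝ) : ℂ) *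
    ((dist (r.get i) z ^ (-p.α / 2) : ℝ) : ℂ)
  have hsig : ∀ hz : ℕ → ℂ, signalOf p r hy hz z =
      ‖∑ i ∈ Finset.range r.1, a i * hz i‖ ^ 2 := by
    intro hz
    rw [signalOf, Config.sum_eq_sum_range r fun i x => ((√p.PR : ℝ) : ℂ) * hz i * conj (hy i) /
      ((‖hy i‖ : ℝ) : ℂ) * ((dist x z ^ (-p.α / 2) : ℝ) : ℂ)]
    congr 3 with i
    simp only [a]
    ring
  have hgain : (relayGain p r z).toNNReal = ∑ i ∈ Finset.range r.1, ‖a i‖₊ ^ 2 := by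
    refine NNReal.coe_injective ?_
    rw [Real.coe_toNNReal _ (hp.relayGain_nonneg r z), NNReal.coe_sum, relayGain,
      Config.sum_eq_sum_range r fun i x => p.PR * dist x z ^ (-p.α)]
    refine Finset.sum_congr rfl fun i _ => ?_
    rw [NNReal.coe_pow, coe_nnnorm]
    have hn : ‖hy i‖ ≠ 0 := norm_ne_zero_iff.2 (hhy i)
    have hd : (dist (r.get i) z ^ (-p.α / 2)) ^ 2 = dist (r.get i) z ^ (-p.α) := by
      rw [← Real.rpow_natCast, ← Real.rpow_mul dist_nonneg]
      congr 1
      push_cast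
      ring
    simp only [a, norm_mul, norm_div, Complex.norm_real, RCLike.norm_conj, norm_norm]
    rw [mul_div_assoc, div_self hn, mul_one, mul_pow, Real.norm_eq_abs, Real.norm_eq_abs, sq_abs,
      sq_abs, Real.sq_sqrt hp.PR_pos.le, hd]
  rw [hgain, ← map_sum_mul_circularGaussian, Measure.map_apply (by fun_prop)
    (show MeasurableSet {w : ℂ | ‖w‖ ^ 2 ∈ A} from
      (show Measurable fun w : ℂ => ‖w‖ ^ 2 by fun_prop) hA)]
  simp_rw [hsig]
  rfl

theorem ae_pos_infinitePi_expMeasure :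
    ∀ᵐ h ∂(Measure.infinitePi fun _ : ℕ => expMeasure 1), ∀ i, 0 < h i := by
  refine ae_all_iff.2 fun i => ?_
  exact (measurePreserving_eval_infinitePi (fun _ : ℕ => expMeasure 1) i).quasiMeasurePreserving.ae
    ae_pos_expMeasure_one

theorem lintegral_exp_neg_sum_expMeasure (n : ℕ) {u : ℕ → ℝ} (hu : ∀ i, 0 ≤ u i) :
    ∫⁻ h, ENNReal.ofReal (Real.exp (-∑ i ∈ Finset.range n, u i * h i))
      ∂(Measure.infinitePi fun _ : ℕ => expMeasure 1) =
      ENNReal.ofReal (∏ i ∈ Finset.range n, (1 + u i)⁻¹) := by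
  have e : ∀ h : ℕ → ℝ, ENNReal.ofReal (Real.exp (-∑ i ∈ Finset.range n, u i * h i)) =
      ∏ i ∈ Finset.range n, ENNReal.ofReal (Real.exp (-(u i * h i))) := by
    intro h
    rw [← Finset.sum_neg_distrib, Real.exp_sum,
      ENNReal.ofReal_prod_of_nonneg fun i _ => (Real.exp_pos _).le]
  simp_rw [e]
  rw [lintegral_prod_eq_prod_lintegral_of_indepFun (Finset.range n)
    (fun i (h : ℕ → ℝ) => ENNReal.ofReal (Real.exp (-(u i * h i))))
    (iIndepFun_infinitePi (P := fun _ : ℕ => expMeasure 1)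
      (X := fun i x => ENNReal.ofReal (Real.exp (-(u i * x)))) (by fun_prop)) (by fun_prop),
    ENNReal.ofReal_prod_of_nonneg fun i _ => by have := hu i; positivity]
  refine Finset.prod_congr rfl fun i _ => ?_
  rw [← lintegral_exp_neg_mul_expMeasure_one (hu i)]
  exact (measurePreserving_eval_infinitePi (fun _ : ℕ => expMeasure 1) i).lintegral_comp
    (f := fun x => ENNReal.ofReal (Real.exp (-(u i * x)))) (by fun_prop)

theorem Params.Admissible.interferenceOf_nonneg {p : Params} (hp : p.Admissible) (j : Config)
    {h : ℕ → ℝ} (hh : ∀ i, 0 < h i) (z : Plane) : 0 ≤ interferenceOf p j h z := by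
  refine Finset.sum_nonneg fun i _ => ?_
  split_ifs
  · exact le_rfl
  · exact mul_nonneg (mul_pos hp.PJ_pos (hh i)).le (Real.rpow_nonneg dist_nonneg _)

theorem mul_interferenceOf (p : Params) (j : Config) (h : ℕ → ℝ) (z : Plane) :
    p.βe * interferenceOf p j h z = ∑ i : Fin j.1, jamGain p (j.2 i) z * h i := by
  rw [interferenceOf, Finset.mul_sum]
  refine Finset.sum_congr rfl fun i _ => ?_
  rw [jamGain]
  split_ifs <;> ring

/-- The conditional outage probability given the locations and the channels to the destination. -/
theorem fading_lt_ratio (p : Params) (hp : p.Admissible) (c : ℝ≥0∞) (r j : Config) (z : Plane)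
    {hy : ℕ → ℂ} (hhy : ∀ i, hy i ≠ 0) :
    ∫⁻ h, (Measure.infinitePi fun _ : ℕ => circularGaussian 0 1)
      {hz | ENNReal.ofReal p.βe < ratio c (signalOf p r hy hz z) (interferenceOf p j h z)}
      ∂(Measure.infinitePi fun _ : ℕ => expMeasure 1) = ENNReal.ofReal (outageOf p c r j z) := by
  classical
  have hs0 := hp.relayGain_nonneg r z
  set s := relayGain p r z with hs
  have h1 : ∀ᵐ h ∂(Measure.infinitePi fun _ : ℕ => expMeasure 1),
      (Measure.infinitePi fun _ : ℕ => circularGaussian 0 1)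
        {hz | ENNReal.ofReal p.βe < ratio c (signalOf p r hy hz z) (interferenceOf p j h z)} =
      if s = 0 then (if (∀ i : Fin j.1, jamGain p (j.2 i) z = 0) ∧ ENNReal.ofReal p.βe < c
          then 1 else 0)
        else ENNReal.ofReal (Real.exp (-∑ i ∈ Finset.range j.1, jamGain p (j.get i) z / s * h i)) := by
    filter_upwards [ae_pos_infinitePi_expMeasure] with h hh
    have hI := hp.interferenceOf_nonneg j hh z
    have hA : MeasurableSet {t | ENNReal.ofReal p.βe < ratio c t (interferenceOf p j h z)} :=
      measurableSet_lt measurable_const (Measurable.ratio c (by fun_prop) (by fun_prop))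
    have := signalOf_measure p hp r z hhy hA
    refine this.trans ((circularGaussian_lt_ratio c hp.βe_pos hI _).trans ?_)
    -- All fadings are positive here, so no interference means that every jammer has gain zero, a
    -- condition on locations only.
    have hzero : interferenceOf p j h z = 0 ↔ ∀ i : Fin j.1, jamGain p (j.2 i) z = 0 := by
      rw [← mul_right_inj' hp.βe_pos.ne', mul_zero, mul_interferenceOf,
        Finset.sum_eq_zero_iff_of_nonneg fun (i : Fin j.1) _ =>
          mul_nonneg (hp.jamGain_nonneg (j.2 i) z) (hh i).le]
      simp [(hh _).ne']
    have hs' : s.toNNReal = 0 ↔ s = 0 := by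
      rw [Real.toNNReal_eq_zero, hs0.ge_iff_eq', eq_comm]
    simp only [hs', hzero, Real.coe_toNNReal s hs0, ← hs]
    split_ifs
    · rfl
    · rfl
    · congr 3
      rw [mul_interferenceOf, Config.sum_eq_sum_range j fun i x => jamGain p x z * h i,
        Finset.sum_div]
      refine Finset.sum_congr rfl fun i _ => ?_
      ring
  rw [lintegral_congr_ae h1, outageOf, ← hs]
  -- Without signal, outage requires `0 / 0`, hence all jammer gains zero. As `jamFactor 0 w` is `1`
  -- for `w = 0` and `0` otherwise, the product is the indicator of this event.
  by_cases h0 : s = 0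
  · simp only [h0, if_true, lintegral_const, measure_univ, mul_one, true_and]
    by_cases hc : ENNReal.ofReal p.βe < c
    · simp only [hc, and_true, not_true_eq_false, if_false, one_mul]
      split_ifs with hall
      · simp [jamFactor, hall]
      · push Not at hall
        obtain ⟨i, hi⟩ := hall
        rw [Finset.prod_eq_zero (Finset.mem_univ i) (by simp [jamFactor, hi]), ENNReal.ofReal_zero]
    · simp [hc]
  · have hsp : 0 < s := lt_of_le_of_ne hs0 (Ne.symm h0)
    simp only [h0, if_false, false_and, one_mul]
    rw [lintegral_exp_neg_sum_expMeasure _ fun i => div_nonneg (hp.jamGain_nonneg _ z) hs0,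
      Config.prod_eq_prod_range j fun i x => jamFactor s (jamGain p x z)]
    simp_rw [jamFactor_of_pos hsp]

/-! ### Joint measurability -/

section Measurability

variable {X : Type*} [MeasurableSpace X]

theorem measurableSet_disk (x : Plane) (r : ℝ) : MeasurableSet (disk x r) := measurableSet_ball

theorem measurable_signalOf (p : Params) {r : X → Config} {hy hz : X → ℕ → ℂ} {z : X → Plane}
    (hr : Measurable r) (hhy : Measurable hy) (hhz : Measurable hz) (hz' : Measurable z) :
    Measurable fun x => signalOf p (r x) (hy x) (hz x) (z x) := by
  refine (Measurable.norm ?_).pow_const 2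
  refine Config.measurable_sum hr (f := fun i x q => ((√p.PR : ℝ) : ℂ) * hz x i * conj (hy x i) /
    ((‖hy x i‖ : ℝ) : ℂ) * ((dist q (z x) ^ (-p.α / 2) : ℝ) : ℂ)) fun i => ?_
  have h1 : Measurable fun q : X × Plane => hz q.1 i :=
    (measurable_pi_apply i).comp (hhz.comp measurable_fst)
  have h2 : Measurable fun q : X × Plane => hy q.1 i :=
    (measurable_pi_apply i).comp (hhy.comp measurable_fst)
  have h3 : Measurable fun q : X × Plane => conj (hy q.1 i) :=
    Complex.continuous_conj.measurable.comp h2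
  have h4 : Measurable fun q : X × Plane => dist q.2 (z q.1) ^ (-p.α / 2) :=
    (measurable_snd.dist (hz'.comp measurable_fst)).pow_const _
  exact (((h1.const_mul _).mul h3).div (Complex.measurable_ofReal.comp h2.norm)).mul
    (Complex.measurable_ofReal.comp h4)

theorem measurable_interferenceOf (p : Params) {j : X → Config} {h : X → ℕ → ℝ} {z : X → Plane}
    (hj : Measurable j) (hh : Measurable h) (hz : Measurable z) :
    Measurable fun x => interferenceOf p (j x) (h x) (z x) := by
  classical
  refine Config.measurable_sum hj (f := fun i x q => if q ∈ disk p.y p.LG then 0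
    else p.PJ * h x i * dist q (z x) ^ (-p.α)) fun i => ?_
  have h1 : Measurable fun q : X × Plane => h q.1 i :=
    (measurable_pi_apply i).comp (hh.comp measurable_fst)
  refine Measurable.ite (measurable_snd (measurableSet_disk _ _)) measurable_const ?_
  exact (h1.const_mul _).mul ((measurable_snd.dist (hz.comp measurable_fst)).pow_const _)

theorem measurable_relayGain (p : Params) {r : X → Config} {z : X → Plane}
    (hr : Measurable r) (hz : Measurable z) : Measurable fun x => relayGain p (r x) (z x) :=
  Config.measurable_sum hr (f := fun _ x q => p.PR * dist q (z x) ^ (-p.α)) fun _ =>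
    ((measurable_snd.dist (hz.comp measurable_fst)).pow_const _).const_mul _

theorem measurable_jamGain (p : Params) {q z : X → Plane} (hq : Measurable q)
    (hz : Measurable z) : Measurable fun x => jamGain p (q x) (z x) := by
  classical
  exact Measurable.ite (hq (measurableSet_disk _ _)) measurable_const
    (((hq.dist hz).pow_const _).const_mul _)

theorem measurable_jamFactor {s w : X → ℝ} (hs : Measurable s) (hw : Measurable w) :
    Measurable fun x => jamFactor (s x) (w x) := by
  classical
  exact Measurable.ite (hw (measurableSet_singleton 0)) measurable_const (hs.div (hs.add hw))

theorem measurable_outageOf (p : Params) (c : ℝ≥0∞) {r j : X → Config} {z : X → Plane}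
    (hr : Measurable r) (hj : Measurable j) (hz : Measurable z) :
    Measurable fun x => outageOf p c (r x) (j x) (z x) := by
  classical
  have hs := measurable_relayGain p hr hz
  refine Measurable.mul (Measurable.ite ?_ measurable_const measurable_const) ?_
  · exact (hs (measurableSet_singleton 0)).inter (MeasurableSet.const _)
  · exact Config.measurable_prod hj
      (f := fun _ x q => jamFactor (relayGain p (r x) (z x)) (jamGain p q (z x))) fun _ =>
      measurable_jamFactor (hs.comp measurable_fst)
        (measurable_jamGain p measurable_snd (hz.comp measurable_fst))

end Measurability

/-! ### The joint law of locations and fading variables -/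

/-- The law of an i.i.d. sequence of `CN(0,1)` channels. -/
abbrev channelLaw : Measure (ℕ → ℂ) := Measure.infinitePi fun _ => circularGaussian 0 1

/-- The law of an i.i.d. sequence of exponential power fadings. -/
abbrev fadingLaw : Measure (ℕ → ℝ) := Measure.infinitePi fun _ => expMeasure 1

/-- Regrouping the double family by receiver yields an i.i.d. sequence of i.i.d. sequences, so that
receivers become coordinates of a product measure. -/
theorem map_curry_eq_infinitePi {Ω E : Type*} [MeasurableSpace Ω] [MeasurableSpace E] {μ : Measure Ω}
    {X : ℕ → ℕ → Ω → E} {ν : Measure E} [IsProbabilityMeasure ν] (hX : ∀ i k, Measurable (X i k))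
    (hmap : ∀ i k, μ.map (X i k) = ν) (hind : iIndepFun (fun q : ℕ × ℕ => X q.1 q.2) μ) :
    μ.map (fun ω k i => X i k ω) = Measure.infinitePi fun _ => Measure.infinitePi fun _ => ν := by
  have h1 := (hind.precomp (g := Prod.swap) Prod.swap_injective).map_fun_eq_infinitePi_map
    (fun q => hX _ _)
  have h2 : (fun q : ℕ × ℕ => μ.map (X q.swap.1 q.swap.2)) = fun _ => ν := funext fun q => hmap _ _
  rw [h2] at h1
  have hm : Measurable fun ω (q : ℕ × ℕ) => X q.swap.1 q.swap.2 ω :=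
    measurable_pi_iff.2 fun q => hX q.swap.1 q.swap.2
  rw [← Measure.infinitePi_map_curry (fun _ _ : ℕ => ν), ← h1,
    Measure.map_map (MeasurableEquiv.measurable _) hm]
  rfl

variable {Ω : Type*}

/-- The channels from the relays to all receivers, grouped by receiver. -/
def Network.channels (N : Network Ω) (ω : Ω) (k i : ℕ) : ℂ := N.Hz i k ω

/-- The power fadings of all receivers, grouped by receiver. -/
def Network.fadings (N : Network Ω) (ω : Ω) (k i : ℕ) : ℝ := N.h i k ω

/-- The channels from the relays to the destination. -/
def Network.mainChannels (N : Network Ω) (ω : Ω) (i : ℕ) : ℂ := N.Hy i ω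

theorem Network.SIR_eq (N : Network Ω) (p : Params) (c : ℝ≥0∞) (k : ℕ) (z : Plane) (ω : Ω) :
    N.SIR p c k z ω = ratio c
      (signalOf p (N.relays ω) (N.mainChannels ω) (N.channels ω k) z)
      (interferenceOf p (N.jammers ω) (N.fadings ω k) z) := rfl

namespace Network.IsModel

variable [MeasurableSpace Ω] {μ : Measure Ω} {p : Params} {N : Network Ω}

theorem measurable_channels (hN : N.IsModel μ p) : Measurable N.channels :=
  measurable_pi_iff.2 fun k => measurable_pi_iff.2 fun i => hN.measurable_Hz i k

theorem measurable_fadings (hN : N.IsModel μ p) : Measurable N.fadings :=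
  measurable_pi_iff.2 fun k => measurable_pi_iff.2 fun i => hN.measurable_h i k

theorem measurable_mainChannels (hN : N.IsModel μ p) : Measurable N.mainChannels :=
  measurable_pi_iff.2 hN.measurable_Hy

theorem map_channels (hN : N.IsModel μ p) : μ.map N.channels = Measure.infinitePi fun _ => channelLaw :=
  map_curry_eq_infinitePi hN.measurable_Hz hN.map_Hz hN.indep_Hz

theorem map_fadings (hN : N.IsModel μ p) : μ.map N.fadings = Measure.infinitePi fun _ => fadingLaw :=
  map_curry_eq_infinitePi hN.measurable_h hN.map_h hN.indep_h

end Network.IsModel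

namespace Network.IsModel

variable [MeasurableSpace Ω] {μ : Measure Ω} {p : Params} {N : Network Ω}

theorem comap_le (hN : N.IsModel μ p) (i : Fin 6) :
    (![MeasurableSpace.comap N.relays inferInstance,
      MeasurableSpace.comap N.jammers inferInstance,
      MeasurableSpace.comap N.eaves inferInstance,
      MeasurableSpace.comap (fun ω (i : ℕ) => N.Hy i ω) inferInstance,
      MeasurableSpace.comap (fun ω (q : ℕ × ℕ) => N.Hz q.1 q.2 ω) inferInstance,
      MeasurableSpace.comap (fun ω (q : ℕ × ℕ) => N.h q.1 q.2 ω) inferInstance] :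
        Fin 6 → MeasurableSpace Ω) i ≤ ‹MeasurableSpace Ω› := by
  fin_cases i
  · exact hN.relays_ppp.measurable.comap_le
  · exact hN.jammers_ppp.measurable.comap_le
  · exact hN.eaves_ppp.measurable.comap_le
  · exact (measurable_pi_iff.2 hN.measurable_Hy).comap_le
  · exact (measurable_pi_iff.2 fun q : ℕ × ℕ => hN.measurable_Hz q.1 q.2).comap_le
  · exact (measurable_pi_iff.2 fun q : ℕ × ℕ => hN.measurable_h q.1 q.2).comap_le

theorem measurable_swap_curry {E : Type*} [MeasurableSpace E] :
    Measurable fun (x : ℕ × ℕ → E) (k i : ℕ) => x (i, k) :=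
  measurable_pi_iff.2 fun _ => measurable_pi_iff.2 fun _ => measurable_pi_apply _

theorem indepFun_locations (hN : N.IsModel μ p) :
    IndepFun (fun ω => (N.relays ω, N.jammers ω, N.eaves ω))
      (fun ω => (N.mainChannels ω, N.fadings ω, N.channels ω)) μ := by
  -- Fadings (5) precede channels (4) because the channels to the receivers are integrated first,
  -- with the fadings fixed.
  have h := indep_iSup_of_disjoint hN.comap_le hN.indep (S := {0, 1, 2}) (T := {3, 5, 4})
    (by simp)
  simp only [iSup_insert, iSup_singleton, Matrix.cons_val, ← MeasurableSpace.comap_prodMk] at h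
  have h' : IndepFun (fun ω => (N.relays ω, N.jammers ω, N.eaves ω))
      (fun ω => (fun i => N.Hy i ω, fun q : ℕ × ℕ => N.h q.1 q.2 ω,
        fun q : ℕ × ℕ => N.Hz q.1 q.2 ω)) μ := h
  exact h'.comp (φ := id) (ψ := fun x => (x.1, fun k i => x.2.1 (i, k), fun k i => x.2.2 (i, k)))
    measurable_id (measurable_fst.prodMk ((measurable_swap_curry.comp
      (measurable_fst.comp measurable_snd)).prodMk (measurable_swap_curry.comp
      (measurable_snd.comp measurable_snd))))

theorem indepFun_mainChannels (hN : N.IsModel μ p) :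
    IndepFun N.mainChannels (fun ω => (N.fadings ω, N.channels ω)) μ := by
  have h := indep_iSup_of_disjoint hN.comap_le hN.indep (S := {3}) (T := {5, 4}) (by simp)
  simp only [iSup_insert, iSup_singleton, Matrix.cons_val, ← MeasurableSpace.comap_prodMk] at h
  have h' : IndepFun (fun ω i => N.Hy i ω)
      (fun ω => (fun q : ℕ × ℕ => N.h q.1 q.2 ω, fun q : ℕ × ℕ => N.Hz q.1 q.2 ω)) μ := h
  exact h'.comp (φ := id) (ψ := fun x => (fun k i => x.1 (i, k), fun k i => x.2 (i, k)))
    measurable_id ((measurable_swap_curry.comp measurable_fst).prodMk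
      (measurable_swap_curry.comp measurable_snd))

theorem indepFun_fadings (hN : N.IsModel μ p) : IndepFun N.fadings N.channels μ := by
  have h := indep_iSup_of_disjoint hN.comap_le hN.indep (S := {5}) (T := {4}) (by simp)
  simp only [iSup_singleton, Matrix.cons_val] at h
  have h' : IndepFun (fun ω (q : ℕ × ℕ) => N.h q.1 q.2 ω)
      (fun ω (q : ℕ × ℕ) => N.Hz q.1 q.2 ω) μ := h
  exact h'.comp measurable_swap_curry measurable_swap_curry

theorem indepFun_eaves (hN : N.IsModel μ p) :
    IndepFun (fun ω => (N.relays ω, N.jammers ω)) N.eaves μ := by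
  have h := indep_iSup_of_disjoint hN.comap_le hN.indep (S := {0, 1}) (T := {2}) (by simp)
  simp only [iSup_insert, iSup_singleton, Matrix.cons_val, ← MeasurableSpace.comap_prodMk] at h
  exact h

theorem indepFun_jammers (hN : N.IsModel μ p) : IndepFun N.relays N.jammers μ := by
  have h := indep_iSup_of_disjoint hN.comap_le hN.indep (S := {0}) (T := {1}) (by simp)
  simp only [iSup_singleton, Matrix.cons_val] at h
  exact h

theorem ae_mainChannels_ne_zero (hN : N.IsModel μ p) :
    ∀ᵐ hy ∂(μ.map N.mainChannels), ∀ i, hy i ≠ 0 := by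
  have h1 := hN.indep_Hy.map_fun_eq_infinitePi_map hN.measurable_Hy
  simp_rw [hN.map_Hy] at h1
  change ∀ᵐ hy ∂(μ.map fun ω i => N.Hy i ω), ∀ i, hy i ≠ 0
  rw [h1]
  refine ae_all_iff.2 fun i => ?_
  refine (measurePreserving_eval_infinitePi
    (fun _ : ℕ => circularGaussian 0 1) i).quasiMeasurePreserving.ae (p := fun w => w ≠ 0) ?_
  have h2 := circularGaussian_norm_sq_gt one_ne_zero (t := 0) le_rfl
  rw [zero_div, neg_zero, Real.exp_zero, ENNReal.ofReal_one] at h2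
  have h3 : ∀ᵐ w ∂(circularGaussian 0 1), 0 < ‖w‖ ^ 2 :=
    (prob_compl_eq_zero_iff (measurableSet_lt measurable_const (by fun_prop))).2 h2
  filter_upwards [h3] with w hw hw0
  simp [hw0] at hw

/-- The probability of an event whose conditional probability given the locations and the channels
to the destination only depends on the locations. -/
theorem measure_eq_lintegral (hN : N.IsModel μ p) [IsProbabilityMeasure μ]
    {A : Set ((Config × Config × Config) × (ℕ → ℂ) × (ℕ → ℕ → ℝ) × (ℕ → ℕ → ℂ))}
    (hA : MeasurableSet A) {φ : Config × Config × Config → ℝ≥0∞} (hφ : Measurable φ)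
    (h : ∀ t hy, (∀ i, hy i ≠ 0) → ∫⁻ h, (Measure.infinitePi fun _ => channelLaw)
      {hz | (t, hy, h, hz) ∈ A} ∂(Measure.infinitePi fun _ => fadingLaw) = φ t) :
    μ {ω | ((N.relays ω, N.jammers ω, N.eaves ω), N.mainChannels ω, N.fadings ω,
      N.channels ω) ∈ A} = ∫⁻ ω, φ (N.relays ω, N.jammers ω, N.eaves ω) ∂μ := by
  have mT : Measurable fun ω => (N.relays ω, N.jammers ω, N.eaves ω) :=
    hN.relays_ppp.measurable.prodMk (hN.jammers_ppp.measurable.prodMk hN.eaves_ppp.measurable)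
  have mF := hN.measurable_fadings.prodMk hN.measurable_channels
  have mH := hN.measurable_mainChannels.prodMk mF
  have e1 := (indepFun_iff_map_prod_eq_prod_map_map mT.aemeasurable mH.aemeasurable).1
    hN.indepFun_locations
  have e2 := (indepFun_iff_map_prod_eq_prod_map_map hN.measurable_mainChannels.aemeasurable
    mF.aemeasurable).1 hN.indepFun_mainChannels
  have e3 := (indepFun_iff_map_prod_eq_prod_map_map hN.measurable_fadings.aemeasurable
    hN.measurable_channels.aemeasurable).1 hN.indepFun_fadings
  -- Nesting the three independence statements identifies the joint law of locations and fading
  -- variables as a product measure.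
  rw [hN.map_fadings, hN.map_channels] at e3
  rw [e3] at e2
  rw [e2] at e1
  have : IsProbabilityMeasure (μ.map N.mainChannels) :=
    Measure.isProbabilityMeasure_map hN.measurable_mainChannels.aemeasurable
  have hpre := Measure.map_apply (μ := μ) (mT.prodMk mH) hA
  rw [e1] at hpre
  refine hpre.symm.trans ?_
  rw [Measure.prod_apply hA, ← lintegral_map hφ mT]
  refine lintegral_congr fun t => ?_
  rw [Measure.prod_apply (measurable_prodMk_left hA)]
  have hae : ∀ᵐ hy ∂(μ.map N.mainChannels),
      ((Measure.infinitePi fun _ => fadingLaw).prod (Measure.infinitePi fun _ => channelLaw))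
        (Prod.mk hy ⁻¹' (Prod.mk t ⁻¹' A)) = φ t := by
    filter_upwards [hN.ae_mainChannels_ne_zero] with hy hhy
    rw [Measure.prod_apply (measurable_prodMk_left (measurable_prodMk_left hA)), ← h t hy hhy]
    rfl
  rw [lintegral_congr_ae hae, lintegral_const, measure_univ, mul_one]

end Network.IsModel

/-! ### Outage events of the receivers given the locations -/

/-- The outage event at `z` given the locations and the channels to the destination, as a set of
fading variables of one receiver. -/
def outageSet (p : Params) (c : ℝ≥0∞) (r j : Config) (hy : ℕ → ℂ) (z : Plane) (h : ℕ → ℝ) :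
    Set (ℕ → ℂ) :=
  {hz | ENNReal.ofReal p.βe < ratio c (signalOf p r hy hz z) (interferenceOf p j h z)}

theorem measurableSet_outage {X : Type*} [MeasurableSpace X] (p : Params) (c : ℝ≥0∞)
    {r j : X → Config} {hy hz : X → ℕ → ℂ} {h : X → ℕ → ℝ} {z : X → Plane}
    (hr : Measurable r) (hj : Measurable j) (hhy : Measurable hy) (hhz : Measurable hz)
    (hh : Measurable h) (hz' : Measurable z) :
    MeasurableSet {x | hz x ∈ outageSet p c (r x) (j x) (hy x) (z x) (h x)} :=
  measurableSet_lt measurable_const (Measurable.ratio c (measurable_signalOf p hr hhy hhz hz')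
    (measurable_interferenceOf p hj hh hz'))

theorem measurableSet_outageSet (p : Params) (c : ℝ≥0∞) (r j : Config) (hy : ℕ → ℂ) (z : Plane)
    (h : ℕ → ℝ) : MeasurableSet (outageSet p c r j hy z h) :=
  measurableSet_outage p c (r := fun _ => r) (j := fun _ => j) (hy := fun _ => hy) (hz := id)
    (h := fun _ => h) (z := fun _ => z) measurable_const measurable_const measurable_const
    measurable_id measurable_const measurable_const

theorem measurable_channelLaw_outageSet (p : Params) (c : ℝ≥0∞) (r j : Config) (hy : ℕ → ℂ)
    (z : Plane) : Measurable fun h => channelLaw (outageSet p c r j hy z h) :=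
  measurable_measure_prodMk_left (ν := channelLaw)
    (s := {x : (ℕ → ℝ) × (ℕ → ℂ) | x.2 ∈ outageSet p c r j hy z x.1})
    (measurableSet_outage p c (r := fun _ => r) (j := fun _ => j) (hy := fun _ => hy)
      (z := fun _ => z) measurable_const measurable_const measurable_const
      measurable_snd measurable_fst measurable_const)

theorem lintegral_channelLaw_outageSet (p : Params) (hp : p.Admissible) (c : ℝ≥0∞)
    (r j : Config) (z : Plane) {hy : ℕ → ℂ} (hhy : ∀ i, hy i ≠ 0) :
    ∫⁻ h, channelLaw (outageSet p c r j hy z h) ∂fadingLaw =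
      ENNReal.ofReal (outageOf p c r j z) :=
  fading_lt_ratio p hp c r j z hhy

theorem lintegral_channelLaw_outageSet_compl (p : Params) (hp : p.Admissible) (c : ℝ≥0∞)
    (r j : Config) (z : Plane) {hy : ℕ → ℂ} (hhy : ∀ i, hy i ≠ 0) :
    ∫⁻ h, channelLaw (outageSet p c r j hy z h)ᶜ ∂fadingLaw =
      ENNReal.ofReal (1 - outageOf p c r j z) := by
  simp_rw [fun h => prob_compl_eq_one_sub (μ := channelLaw)
    (measurableSet_outageSet p c r j hy z h)]
  rw [lintegral_sub (measurable_channelLaw_outageSet p c r j hy z)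
    (by rw [lintegral_channelLaw_outageSet p hp c r j z hhy]; exact ENNReal.ofReal_ne_top)
    (Filter.Eventually.of_forall fun _ => prob_le_one),
    lintegral_channelLaw_outageSet p hp c r j z hhy, lintegral_const, measure_univ, mul_one,
    ENNReal.ofReal_sub _ (hp.outageOf_nonneg c r j z), ENNReal.ofReal_one]

/-- Given the locations and the channels to the destination, the outage events of the receivers are
independent. -/
theorem lintegral_forall_notMem_outageSet (p : Params) (hp : p.Admissible) (c : ℝ≥0∞)
    (r j e : Config) {hy : ℕ → ℂ} (hhy : ∀ i, hy i ≠ 0) :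
    ∫⁻ h, (Measure.infinitePi fun _ : ℕ => channelLaw)
      {hz | ∀ k : Fin e.1, hz k ∉ outageSet p c r j hy (e.2 k) (h k)}
      ∂(Measure.infinitePi fun _ : ℕ => fadingLaw) =
    ENNReal.ofReal (∏ k, (1 - outageOf p c r j (e.2 k))) := by
  -- With the fadings fixed, the event is a box in the channel sequences of the receivers. Its
  -- probability is a product whose `k`-th factor involves only `h k`, so integrating over the
  -- independent `h k` factorises again.
  have h1 : ∀ h : ℕ → ℕ → ℝ, (Measure.infinitePi fun _ : ℕ => channelLaw)
      {hz | ∀ k : Fin e.1, hz k ∉ outageSet p c r j hy (e.2 k) (h k)} =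
      ∏ k ∈ Finset.range e.1, channelLaw (outageSet p c r j hy (e.get k) (h k))ᶜ := by
    intro h
    rw [← Measure.infinitePi_pi (fun _ : ℕ => channelLaw) fun k _ =>
      (measurableSet_outageSet p c r j hy (e.get k) (h k)).compl]
    congr 1
    ext hz
    simp only [Set.mem_ofPred_eq, Set.mem_pi, Finset.mem_coe, Finset.mem_range, Set.mem_compl_iff]
    refine ⟨fun H k hk => ?_, fun H k => ?_⟩
    · rw [e.get_val ⟨k, hk⟩]
      exact H ⟨k, hk⟩
    · rw [← e.get_val k]
      exact H k k.2
  have hm : ∀ k, Measurable fun h => channelLaw (outageSet p c r j hy (e.get k) h)ᶜ := fun k => by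
    simp_rw [fun h => prob_compl_eq_one_sub (μ := channelLaw)
      (measurableSet_outageSet p c r j hy (e.get k) h)]
    exact (measurable_channelLaw_outageSet p c r j hy _).const_sub 1
  simp_rw [h1]
  rw [lintegral_prod_eq_prod_lintegral_of_indepFun (Finset.range e.1)
    (fun k (h : ℕ → ℕ → ℝ) => channelLaw (outageSet p c r j hy (e.get k) (h k))ᶜ)
    (iIndepFun_infinitePi (P := fun _ : ℕ => fadingLaw)
      (X := fun k h => channelLaw (outageSet p c r j hy (e.get k) h)ᶜ) hm)
    fun k => (hm k).comp (measurable_pi_apply k),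
    Config.prod_eq_prod_range e fun _ x => 1 - outageOf p c r j x,
    ENNReal.ofReal_prod_of_nonneg fun _ _ => sub_nonneg.2 (hp.outageOf_le_one c r j _)]
  refine Finset.prod_congr rfl fun k _ => ?_
  rw [← lintegral_channelLaw_outageSet_compl p hp c r j (e.get k) hhy]
  exact (measurePreserving_eval_infinitePi (fun _ : ℕ => fadingLaw) k).lintegral_comp (hm k)

namespace Network.IsModel

variable [MeasurableSpace Ω] {μ : Measure Ω} {p : Params} {N : Network Ω}

theorem measurableSet_SIR_gt (hN : N.IsModel μ p) (c : ℝ≥0∞) (k : ℕ) (z : Plane) :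
    MeasurableSet {ω | ENNReal.ofReal p.βe < N.SIR p c k z ω} := by
  have hz : Measurable fun ω => N.channels ω k :=
    (measurable_pi_apply k).comp hN.measurable_channels
  have hh : Measurable fun ω => N.fadings ω k :=
    (measurable_pi_apply k).comp hN.measurable_fadings
  have hm : Measurable fun ω => N.SIR p c k z ω := by
    simp only [Network.SIR_eq]
    exact Measurable.ratio c (measurable_signalOf p hN.relays_ppp.measurable
      hN.measurable_mainChannels hz measurable_const)
      (measurable_interferenceOf p hN.jammers_ppp.measurable hh measurable_const)
  exact measurableSet_lt measurable_const hm

theorem measureReal_SIR_gt (hN : N.IsModel μ p) [IsProbabilityMeasure μ] (hp : p.Admissible)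
    (c : ℝ≥0∞) (z : Plane) : μ.real {ω | ENNReal.ofReal p.βe < N.SIR p c 0 z ω} =
      ∫ ω, outageOf p c (N.relays ω) (N.jammers ω) z ∂μ := by
  have hout := measurable_outageOf p c hN.relays_ppp.measurable hN.jammers_ppp.measurable
    (measurable_const (a := z))
  rw [integral_eq_lintegral_of_nonneg_ae
    (Filter.Eventually.of_forall fun ω => hp.outageOf_nonneg c _ _ z) hout.aestronglyMeasurable,
    measureReal_def]
  congr 1
  refine hN.measure_eq_lintegral
    (A := {x | x.2.2.2 0 ∈ outageSet p c x.1.1 x.1.2.1 x.2.1 z (x.2.2.1 0)})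
    (measurableSet_outage p c (by fun_prop) (by fun_prop) (by fun_prop) (by fun_prop)
      (by fun_prop) measurable_const)
    (φ := fun t => ENNReal.ofReal (outageOf p c t.1 t.2.1 z))
    (measurable_outageOf p c measurable_fst (measurable_fst.comp measurable_snd)
      measurable_const).ennreal_ofReal fun t hy hhy => ?_
  rw [← lintegral_channelLaw_outageSet p hp c t.1 t.2.1 z hhy]
  have h1 : ∀ h : ℕ → ℕ → ℝ, (Measure.infinitePi fun _ : ℕ => channelLaw)
      {hz | hz 0 ∈ outageSet p c t.1 t.2.1 hy z (h 0)} =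
      channelLaw (outageSet p c t.1 t.2.1 hy z (h 0)) := fun h =>
    (measurePreserving_eval_infinitePi (fun _ : ℕ => channelLaw) 0).measure_preimage
      (measurableSet_outageSet p c t.1 t.2.1 hy z (h 0)).nullMeasurableSet
  refine (lintegral_congr h1).trans ?_
  exact (measurePreserving_eval_infinitePi (fun _ : ℕ => fadingLaw) 0).lintegral_comp
    (measurable_channelLaw_outageSet p c t.1 t.2.1 hy z)

/-- A conditional probability averages to the unconditional one, which `measureReal_SIR_gt` has
computed. -/
theorem integral_condOutage (hN : N.IsModel μ p) [IsProbabilityMeasure μ] (hp : p.Admissible)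
    (c : ℝ≥0∞) (z : Plane) : ∫ ω, N.condOutage μ p c z ω ∂μ =
      ∫ ω, outageOf p c (N.relays ω) (N.jammers ω) z ∂μ := by
  rw [← hN.measureReal_SIR_gt hp c z, Network.condOutage, integral_condExp
    (sup_le hN.relays_ppp.measurable.comap_le hN.jammers_ppp.measurable.comap_le),
    integral_indicator (hN.measurableSet_SIR_gt c 0 z)]
  simp

theorem SOP_eq (hN : N.IsModel μ p) [IsProbabilityMeasure μ] (hp : p.Admissible)
    (c : ℝ≥0∞) : N.SOP μ p c = 1 - ∫ ω, ∏ k : Fin (N.eaves ω).1,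
      (1 - outageOf p c (N.relays ω) (N.jammers ω) ((N.eaves ω).2 k)) ∂μ := by
  have hset : {ω | ∃ k : Fin (N.eaves ω).1,
      ENNReal.ofReal p.βe < N.SIR p c k ((N.eaves ω).2 k) ω}ᶜ =
      {ω | ((N.relays ω, N.jammers ω, N.eaves ω), N.mainChannels ω, N.fadings ω, N.channels ω) ∈
        {x : (Config × Config × Config) × (ℕ → ℂ) × (ℕ → ℕ → ℝ) × (ℕ → ℕ → ℂ) |
          ∀ k : Fin x.1.2.2.1, x.2.2.2 k ∉
            outageSet p c x.1.1 x.1.2.1 x.2.1 (x.1.2.2.2 k) (x.2.2.1 k)}} := by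
    ext ω
    simp only [Set.mem_compl_iff, Set.mem_ofPred_eq, not_exists]
    rfl
  have hA : MeasurableSet
      {x : (Config × Config × Config) × (ℕ → ℂ) × (ℕ → ℕ → ℝ) × (ℕ → ℕ → ℂ) |
          ∀ k : Fin x.1.2.2.1, x.2.2.2 k ∉
            outageSet p c x.1.1 x.1.2.1 x.2.1 (x.1.2.2.2 k) (x.2.2.1 k)} := by
    -- The quantifier over a random number of receivers becomes a countable intersection over all
    -- indices, with `Config.get` supplying the locations.
    have e : {x : (Config × Config × Config) × (ℕ → ℂ) × (ℕ → ℕ → ℝ) × (ℕ → ℕ → ℂ) |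
          ∀ k : Fin x.1.2.2.1, x.2.2.2 k ∉
            outageSet p c x.1.1 x.1.2.1 x.2.1 (x.1.2.2.2 k) (x.2.2.1 k)} =
        ⋂ k : ℕ, ({x | k < x.1.2.2.1} ∩ {x | x.2.2.2 k ∈
            outageSet p c x.1.1 x.1.2.1 x.2.1 (x.1.2.2.get k) (x.2.2.1 k)})ᶜ := by
      ext x
      simp only [Set.mem_ofPred_eq, Set.mem_iInter, Set.mem_compl_iff, Set.mem_inter_iff, not_and]
      refine ⟨fun H k hk => ?_, fun H k => ?_⟩
      · rw [x.1.2.2.get_val ⟨k, hk⟩]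
        exact H ⟨k, hk⟩
      · rw [← x.1.2.2.get_val k]
        exact H k k.2
    rw [e]
    refine MeasurableSet.iInter fun k => MeasurableSet.compl (MeasurableSet.inter ?_ ?_)
    · exact measurableSet_lt measurable_const
        (Config.measurable_card.comp (measurable_snd.comp (measurable_snd.comp measurable_fst)))
    · exact measurableSet_outage p c (by fun_prop) (by fun_prop) (by fun_prop) (by fun_prop)
        (by fun_prop) ((Config.measurable_get k).comp
          (measurable_snd.comp (measurable_snd.comp measurable_fst)))
  have hφ : Measurable fun t : Config × Config × Config =>
      ∏ k, (1 - outageOf p c t.1 t.2.1 (t.2.2.2 k)) :=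
    Config.measurable_prod (measurable_snd.comp measurable_snd)
      (f := fun _ t x => 1 - outageOf p c t.1 t.2.1 x) fun _ =>
      (measurable_outageOf p c (measurable_fst.comp measurable_fst)
        (measurable_fst.comp (measurable_snd.comp measurable_fst)) measurable_snd).const_sub 1
  have mT : Measurable fun ω => (N.relays ω, N.jammers ω, N.eaves ω) :=
    hN.relays_ppp.measurable.prodMk (hN.jammers_ppp.measurable.prodMk hN.eaves_ppp.measurable)
  have mAll := mT.prodMk (hN.measurable_mainChannels.prodMk
    (hN.measurable_fadings.prodMk hN.measurable_channels))
  have hP := hN.measure_eq_lintegral hA hφ.ennreal_ofReal fun t hy hhy =>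
    lintegral_forall_notMem_outageSet p hp c t.1 t.2.1 t.2.2 hhy
  rw [← hset] at hP
  have hmeas : MeasurableSet {ω | ∃ k : Fin (N.eaves ω).1,
      ENNReal.ofReal p.βe < N.SIR p c k ((N.eaves ω).2 k) ω} := by
    rw [← MeasurableSet.compl_iff, hset]
    exact mAll hA
  rw [Network.SOP, integral_eq_lintegral_of_nonneg_ae (Filter.Eventually.of_forall fun ω =>
    Finset.prod_nonneg fun k _ => sub_nonneg.2 (hp.outageOf_le_one c _ _ _))
    (hφ.comp mT).aestronglyMeasurable, ← hP, ← measureReal_def, probReal_compl_eq_one_sub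
    hmeas]
  ring

end Network.IsModel

/-! ### Averaging over the Poisson processes, and Jensen's inequality -/

theorem integral_jamFactor (p : Params) (hp : p.Admissible) {s : ℝ} (hs : 0 ≤ s) (z : Plane) :
    ∫ x in annulus p.L₁ p.L₂, (1 - jamFactor s (jamGain p x z)) =
      ∫ x in p.jamRegion, p.βe * p.PJ * dist x z ^ (-p.α) /
        (s + p.βe * p.PJ * dist x z ^ (-p.α)) := by
  -- Silent jammers have factor `1`, so the integrand vanishes on the protected zone and the
  -- integral may be restricted to its complement.
  rw [Params.jamRegion, Set.sdiff_eq, ← setIntegral_indicator (measurableSet_disk _ _).compl]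
  congr with x
  have hw := hp.jamGain_nonneg x z
  by_cases hx : x ∈ disk p.y p.LG
  · simp [jamGain, jamFactor, hx]
  · rw [Set.indicator_of_mem (by exact hx)]
    simp only [jamGain, hx, if_false] at hw ⊢
    rw [jamFactor]
    split_ifs with h0
    · simp [h0]
    · have : 0 < s + p.βe * p.PJ * dist x z ^ (-p.α) :=
        add_pos_of_nonneg_of_pos hs (lt_of_le_of_ne hw (Ne.symm h0))
      rw [one_sub_div this.ne', add_sub_cancel_left]

theorem outageOf_mono (p : Params) (hp : p.Admissible) {c c' : ℝ≥0∞} (hc : c ≤ c')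
    (r j : Config) (z : Plane) : outageOf p c r j z ≤ outageOf p c' r j z := by
  refine mul_le_mul_of_nonneg_right ?_ (Finset.prod_nonneg fun _ _ =>
    jamFactor_nonneg (hp.relayGain_nonneg r z) (hp.jamGain_nonneg _ z))
  split_ifs with h1 h2
  · exact le_rfl
  · exact zero_le_one
  · exact absurd ⟨by tauto, fun h => by have := h.trans_le hc; tauto⟩ h1
  · exact le_rfl

theorem outageOf_of_lt (p : Params) {c : ℝ≥0∞} (hc : ENNReal.ofReal p.βe < c) (r j : Config)
    (z : Plane) : outageOf p c r j z =
      ∏ i, jamFactor (relayGain p r z) (jamGain p (j.2 i) z) := by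
  simp [outageOf, hc]

theorem integrable_of_mem_unit {X : Type*} [MeasurableSpace X] {ν : Measure X} [IsFiniteMeasure ν]
    {f : X → ℝ} (hf : Measurable f) (h0 : ∀ x, 0 ≤ f x) (h1 : ∀ x, f x ≤ 1) : Integrable f ν :=
  Integrable.of_bound hf.aestronglyMeasurable 1 (Filter.Eventually.of_forall fun x => by
    rw [Real.norm_of_nonneg (h0 x)]
    exact h1 x)

theorem _root_.ProbabilityTheory.IndepFun.integral_comp_prod {Ω X Y : Type*} [MeasurableSpace Ω]
    [MeasurableSpace X] [MeasurableSpace Y] {μ : Measure Ω} [IsProbabilityMeasure μ] {f : Ω → X}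
    {g : Ω → Y} (h : IndepFun f g μ) (hf : Measurable f) (hg : Measurable g) {F : X → Y → ℝ}
    (hF : Measurable fun q : X × Y => F q.1 q.2) (h0 : ∀ x y, 0 ≤ F x y) (h1 : ∀ x y, F x y ≤ 1) :
    ∫ ω, F (f ω) (g ω) ∂μ = ∫ ω, ∫ ω', F (f ω) (g ω') ∂μ ∂μ := by
  have : IsProbabilityMeasure (μ.map f) := Measure.isProbabilityMeasure_map hf.aemeasurable
  have : IsProbabilityMeasure (μ.map g) := Measure.isProbabilityMeasure_map hg.aemeasurable
  have e := (indepFun_iff_map_prod_eq_prod_map_map hf.aemeasurable hg.aemeasurable).1 h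
  have e1 := integral_map (μ := μ) (hf.prodMk hg).aemeasurable
    (f := fun q : X × Y => F q.1 q.2) hF.aestronglyMeasurable
  rw [← e1, e, integral_prod _ (integrable_of_mem_unit hF (fun q => h0 q.1 q.2) fun q => h1 q.1 q.2)]
  have hsm : StronglyMeasurable fun x => ∫ y, F x y ∂(μ.map g) :=
    StronglyMeasurable.integral_prod_right (f := F) hF.stronglyMeasurable
  rw [integral_map hf.aemeasurable hsm.aestronglyMeasurable]
  refine integral_congr_ae (Filter.Eventually.of_forall fun ω => ?_)
  exact integral_map hg.aemeasurable (hF.comp measurable_prodMk_left).aestronglyMeasurable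

namespace Network.IsModel

variable [MeasurableSpace Ω] {μ : Measure Ω} {p : Params} {N : Network Ω}

/-- The secrecy outage probability, after averaging over the fading and the eavesdroppers. -/
theorem SOP_eq_integral_exp (hN : N.IsModel μ p) [IsProbabilityMeasure μ] (hp : p.Admissible)
    (c : ℝ≥0∞) : N.SOP μ p c = 1 - ∫ ω, Real.exp (-(p.lamE *
      ∫ z in annulus p.L₁ p.L₂, outageOf p c (N.relays ω) (N.jammers ω) z)) ∂μ := by
  rw [hN.SOP_eq hp c]
  congr 1
  have hF : Measurable fun q : (Config × Config) × Config =>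
      ∏ k, (1 - outageOf p c q.1.1 q.1.2 (q.2.2 k)) :=
    Config.measurable_prod (c := fun q : (Config × Config) × Config => q.2) measurable_snd
      (f := fun _ q x => 1 - outageOf p c q.1.1 q.1.2 x) fun _ =>
      (measurable_outageOf p c (measurable_fst.comp (measurable_fst.comp measurable_fst))
        (measurable_snd.comp (measurable_fst.comp measurable_fst)) measurable_snd).const_sub 1
  have h01 : ∀ r j z, 0 ≤ 1 - outageOf p c r j z := fun r j z =>
    sub_nonneg.2 (hp.outageOf_le_one c r j z)
  have h11 : ∀ r j z, 1 - outageOf p c r j z ≤ 1 := fun r j z =>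
    sub_le_self _ (hp.outageOf_nonneg c r j z)
  have hF0 : ∀ (q : Config × Config) (e : Config),
      0 ≤ ∏ k, (1 - outageOf p c q.1 q.2 (e.2 k)) := fun q e =>
    Finset.prod_nonneg fun k _ => h01 q.1 q.2 (e.2 k)
  have hF1 : ∀ (q : Config × Config) (e : Config),
      ∏ k, (1 - outageOf p c q.1 q.2 (e.2 k)) ≤ 1 := fun q e =>
    Finset.prod_le_one (fun k _ => h01 q.1 q.2 (e.2 k)) fun k _ => h11 q.1 q.2 (e.2 k)
  -- Relays and jammers are frozen by independence, and the generating functional of the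
  -- eavesdroppers is applied to the then deterministic function `1 - outageOf`.
  refine (hN.indepFun_eaves.integral_comp_prod (hN.relays_ppp.measurable.prodMk
    hN.jammers_ppp.measurable) hN.eaves_ppp.measurable hF hF0 hF1).trans ?_
  refine integral_congr_ae (Filter.Eventually.of_forall fun ω => ?_)
  have h := hN.eaves_ppp.integral_prod (volume_annulus_ne_top _ _)
    (f := fun z => 1 - outageOf p c (N.relays ω) (N.jammers ω) z)
    ((measurable_outageOf p c measurable_const measurable_const measurable_id).const_sub 1)
    (fun z => h01 _ _ _) (fun z => h11 _ _ _)
  simpa only [sub_sub_cancel] using h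

/-- The outage probability at a fixed point, after averaging over the jammers. -/
theorem integral_outageOf_of_lt (hN : N.IsModel μ p) [IsProbabilityMeasure μ]
    (hp : p.Admissible) {c : ℝ≥0∞} (hc : ENNReal.ofReal p.βe < c) (z : Plane) :
    ∫ ω, outageOf p c (N.relays ω) (N.jammers ω) z ∂μ =
      ∫ ω, Real.exp (-(p.lamJ : ℝ) * ∫ x in p.jamRegion, p.βe * p.PJ * dist x z ^ (-p.α) /
        ((∑ i : Fin (N.relays ω).1, p.PR * dist ((N.relays ω).2 i) z ^ (-p.α)) +
          p.βe * p.PJ * dist x z ^ (-p.α))) ∂μ := by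
  rw [hN.indepFun_jammers.integral_comp_prod hN.relays_ppp.measurable hN.jammers_ppp.measurable
    (F := fun r j => outageOf p c r j z)
    (measurable_outageOf p c measurable_fst measurable_snd measurable_const)
    (fun r j => hp.outageOf_nonneg c r j z) (fun r j => hp.outageOf_le_one c r j z)]
  refine integral_congr_ae (Filter.Eventually.of_forall fun ω => ?_)
  have hs := hp.relayGain_nonneg (N.relays ω) z
  have h := hN.jammers_ppp.integral_prod (volume_annulus_ne_top _ _)
    (f := fun x => jamFactor (relayGain p (N.relays ω) z) (jamGain p x z))
    (measurable_jamFactor measurable_const (measurable_jamGain p measurable_id measurable_const))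
    (fun x => jamFactor_nonneg hs (hp.jamGain_nonneg x z))
    (fun x => jamFactor_le_one hs (hp.jamGain_nonneg x z))
  rw [integral_jamFactor p hp hs z, ← neg_mul] at h
  simp only [outageOf_of_lt p hc]
  exact h

theorem integrable_outageOf (hN : N.IsModel μ p) [IsProbabilityMeasure μ] (hp : p.Admissible)
    (c : ℝ≥0∞) : Integrable (fun q : Ω × Plane => outageOf p c (N.relays q.1) (N.jammers q.1) q.2)
      (μ.prod (volume.restrict (annulus p.L₁ p.L₂))) := by
  have : IsFiniteMeasure (volume.restrict (annulus p.L₁ p.L₂)) :=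
    ⟨by simpa using (volume_annulus_ne_top p.L₁ p.L₂).lt_top⟩
  exact integrable_of_mem_unit (measurable_outageOf p c
    (hN.relays_ppp.measurable.comp measurable_fst) (hN.jammers_ppp.measurable.comp measurable_fst)
    measurable_snd) (fun q => hp.outageOf_nonneg c _ _ _) fun q => hp.outageOf_le_one c _ _ _

/-- Jensen's inequality for `exp` moves the expectation over relays and jammers into the exponent,
where Fubini exchanges it with the integral over the annulus. -/
theorem SOP_le_jensenBound (hN : N.IsModel μ p) [IsProbabilityMeasure μ] (hp : p.Admissible)
    (c : ℝ≥0∞) : N.SOP μ p c ≤ N.jensenBound μ p c := by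
  have hint := hN.integrable_outageOf hp c
  rw [hN.SOP_eq_integral_exp hp c, Network.jensenBound]
  simp_rw [hN.integral_condOutage hp c]
  rw [← integral_integral_swap hint, neg_mul, ← integral_const_mul, ← integral_neg]
  have hX : Integrable (fun ω => -(p.lamE * ∫ z in annulus p.L₁ p.L₂,
      outageOf p c (N.relays ω) (N.jammers ω) z)) μ :=
    (hint.integral_prod_left.const_mul _).neg
  have hX0 : ∀ ω, -(p.lamE * ∫ z in annulus p.L₁ p.L₂,
      outageOf p c (N.relays ω) (N.jammers ω) z) ≤ 0 := fun ω =>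
    neg_nonpos.2 (mul_nonneg p.lamE.2 (integral_nonneg fun z => hp.outageOf_nonneg c _ _ z))
  refine sub_le_sub_left (convexOn_exp.map_integral_le Real.continuous_exp.continuousOn
    isClosed_univ (Filter.Eventually.of_forall fun _ => Set.mem_univ _) hX ?_) 1
  -- The exponent is nonpositive, so its exponential is bounded by `1`.
  exact Integrable.of_bound (Real.continuous_exp.comp_aestronglyMeasurable hX.aestronglyMeasurable)
    1 (Filter.Eventually.of_forall fun ω => by
      rw [Function.comp_apply, Real.norm_of_nonneg (Real.exp_pos _).le]
      exact Real.exp_le_one_iff.2 (hX0 ω))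

theorem jensenBound_eq_explicitBound (hN : N.IsModel μ p) [IsProbabilityMeasure μ]
    (hp : p.Admissible) {c : ℝ≥0∞} (hc : ENNReal.ofReal p.βe < c) :
    N.jensenBound μ p c = N.explicitBound μ p := by
  simp_rw [Network.jensenBound, Network.explicitBound, hN.integral_condOutage hp c,
    hN.integral_outageOf_of_lt hp hc]

theorem jensenBound_mono (hN : N.IsModel μ p) [IsProbabilityMeasure μ] (hp : p.Admissible)
    {c c' : ℝ≥0∞} (hc : c ≤ c') : N.jensenBound μ p c ≤ N.jensenBound μ p c' := by
  simp_rw [Network.jensenBound, hN.integral_condOutage hp]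
  refine sub_le_sub_left (Real.exp_le_exp.2 (mul_le_mul_of_nonpos_left ?_
    (neg_nonpos.2 p.lamE.2))) 1
  refine integral_mono (hN.integrable_outageOf hp c).integral_prod_right
    (hN.integrable_outageOf hp c').integral_prod_right fun z => ?_
  exact integral_mono
    (integrable_of_mem_unit (measurable_outageOf p c hN.relays_ppp.measurable
      hN.jammers_ppp.measurable measurable_const) (fun _ => hp.outageOf_nonneg c _ _ _)
      fun _ => hp.outageOf_le_one c _ _ _)
    (integrable_of_mem_unit (measurable_outageOf p c' hN.relays_ppp.measurable
      hN.jammers_ppp.measurable measurable_const) (fun _ => hp.outageOf_nonneg c' _ _ _)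
      fun _ => hp.outageOf_le_one c' _ _ _) fun ω => outageOf_mono p hp hc _ _ z

/-- The convention `∞` maximises the left side, and it exceeds the finite threshold, so equality
holds there. -/
theorem jensenBound_le_explicitBound (hN : N.IsModel μ p) [IsProbabilityMeasure μ]
    (hp : p.Admissible) (c : ℝ≥0∞) : N.jensenBound μ p c ≤ N.explicitBound μ p :=
  (hN.jensenBound_mono hp le_top).trans_eq
    (hN.jensenBound_eq_explicitBound hp ENNReal.ofReal_lt_top)

end Network.IsModel

end SecrecyOutage

end

theorem mainTheorem5 {Ω : Type*} [MeasurableSpace Ω] (μ : Measure Ω) [IsProbabilityMeasure μ]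
    (p : SecrecyOutage.Params) (hp : p.Admissible)
    (N : SecrecyOutage.Network Ω) (hN : N.IsModel μ p) (c : ℝ≥0∞) :
    N.SOP μ p c ≤ N.explicitBound μ p ∧
      N.SOP μ p c ≤ N.jensenBound μ p c ∧
      N.jensenBound μ p c ≤ N.explicitBound μ p ∧
      (ENNReal.ofReal p.βe < c → N.jensenBound μ p c = N.explicitBound μ p) :=
  ⟨(hN.SOP_le_jensenBound hp c).trans (hN.jensenBound_le_explicitBound hp c),
    hN.SOP_le_jensenBound hp c, hN.jensenBound_le_explicitBound hp c,
    hN.jensenBound_eq_explicitBound hp⟩
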